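/- Let $\mathcal L$ be a first-order language, $\mathcal I$ a proper ideal on a set $I$, $(\mathcal M_i)_{i\in I}$ a family of (nonempty) $\mathcal L$-structures, and $\mathcal M=\prod_{\mathcal I}\mathcal M_i$ the reduced product: the quotient of $\prod_i\mathcal M_i$ by $a\simeq b\Leftrightarrow\{i: a_i\ne b_i\}\in\mathcal I$, with functions computed coordinatewise and $R(a^1,\dots,a^n)$ true iff $\{i:\mathcal M_i\not\models R(a^1_i,\dots,a^n_i)\}\in\mathcal I$. Let $\mathcal P(I)/\mathcal I$ be the quotient Boolean algebra ($A\simeq B$ iff $A\,\triangle\, B\in\mathcal I$). For an $\mathcal L$-formula $\varphi(x_1,\dots,x_n)$ and $\bar a\in\mathcal M^n$ put $\mathrm{supp}_\varphi(\bar a)=[\{i:\mathcal M_i\models\varphi(\bar a_i)\}]_{\mathcal I}$; for a sentence $\theta$ this is the constant $c_\theta=[\{i:\mathcal M_i\models\theta\}]_{\mathcal I}$. Put $\mathrm{supp}_=(a,b)=[\{i:a_i=b_i\}]_{\mathcal I}$. The *$h$-formulas* are the smallest class of formulas containing the atomic formulas and containing with $\varphi,\psi$ also $\varphi\wedge\psi$,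 $\exists x\,\varphi$, $\forall x\,\varphi$ and $\exists x\,\varphi\wedge\forall x(\varphi\to\psi)$. A set $\Phi$ of $\mathcal L$-formulas is *fundamental* for $(\mathcal M_i)$ and $\mathcal I$ if for every $\mathcal L$-formula $\psi(\bar x)$ there is a Boolean combination $\beta(\bar x)$ of formulas from $\Phi$ (with variables from $\bar x$ written for their variables; $\bot$ is allowed) such that $\mathcal M_i\models\forall\bar x(\psi\leftrightarrow\beta)$ for all $i$ outside a set in $\mathcal I$. For $A\subseteq\mathcal M$, an *interpretation of $\mathcal P(I)/\mathcal I$ in $\mathcal M$ over $A$* is a surjection $\pi:D\to\mathcal P(I)/\mathcal I$, with $D\subseteq\mathcal M^d$ for some $d$, such that $D$ and the pullbacks under $\pi$ of equality and of the graphs of $0,1,{}^{\complement},\cap,\cup$ are definable in the $\mathcal L$-structure $\mathcal M$ with parameters from $A$. Such an interpretation *interprets* a function $f:\mathcal M^n\to\mathcal P(I)/\mathcal I$ if $\{(\bar a,\bar d)\in\mathcal M^n\times D: f(\bar a)=\pi(\bar d)\}$ is definable in $\mathcal M$ with parameters from $A$. (For $A=\emptyset$ this is interpretation without parameters.) For a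 set $\Phi$ of $\mathcal L$-formulas, $\mathcal L^+_\Phi$ is the two-sorted language consisting of $\mathcal L$ on the main sort $\mathcal M$, the language $(\cap,\cup,0,1,{}^{\complement})$ on the Boolean sort $\mathcal P(I)/\mathcal I$, function symbols $\mathrm{supp}_\varphi$ from the main to the Boolean sort for $\varphi\in\Phi$, and constants $c_\theta$ for the sentences $\theta\in\Phi$; $\mathcal L^+$ is the case where $\Phi$ is the set of all $\mathcal L$-formulas. *$\mathcal M$ eliminates quantifiers relative to $\mathcal P(I)/\mathcal I$ in $\mathcal L^+_\Phi$* if every $\mathcal L^+_\Phi$-formula is equivalent, in the two-sorted structure $(\mathcal M,\mathcal P(I)/\mathcal I)$, to a Boolean combination, in the same free variables, of atomic formulas and of formulas $\psi(s_1,\dots,s_r)$, where $\psi$ is a formula of the language of the Boolean sort and the $s_j$ are $\mathcal L^+_\Phi$-terms of the Boolean sort. **Theorem.** Let $\Phi$ be a fundamental set of $h$-formulas for $(\mathcal M_i)_{i\in I}$ and $\mathcal I$. Assume that every formula in $\Phi$ is satisfiable in $\mathcal M$, or that every relation symbol of $\mathcal L$ has a nonempty interpretation in $\mathcal M$. Let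 $A\subseteq\mathcal M$, and suppose that an interpretation of $\mathcal P(I)/\mathcal I$ in $\mathcal M$ over $A$ interprets $\mathrm{supp}_=$. Then this same interpretation interprets over $A$ every function of $\mathcal L^+$, that is, $\mathrm{supp}_\varphi$ for every $\mathcal L$-formula $\varphi$ and $c_\theta$ for every $\mathcal L$-sentence $\theta$. Moreover $\mathcal M$ eliminates quantifiers relative to $\mathcal P(I)/\mathcal I$ in $\mathcal L^+_\Phi$. -/

import Mathlib

universe u v w x

namespace FV

open FirstOrder FirstOrder.Language
open scoped symmDiff

/-! ### The quotient Boolean algebra of an ideal of sets -/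

/-- `A` and `B` are identified when their symmetric difference lies in the ideal. -/
def powersetSetoid {I : Type w} (𝓘 : Order.Ideal (Set I)) : Setoid (Set I) where
  r A B := A ∆ B ∈ 𝓘
  iseqv :=
    { refl := fun A => by rw [symmDiff_self]; exact 𝓘.bot_mem
      symm := fun {A B} h => by rwa [symmDiff_comm]
      trans := fun {A B C} h₁ h₂ =>
        𝓘.lower (symmDiff_triangle A B C) (Order.Ideal.sup_mem h₁ h₂) }

/-- The quotient `P(I)/𝓘`. -/
def PowersetQuotient {I : Type w} (𝓘 : Order.Ideal (Set I)) : Type w :=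
  Quotient (powersetSetoid 𝓘)

namespace PowersetQuotient

variable {I : Type w} {𝓘 : Order.Ideal (Set I)}

/-- The class of a set. -/
def mk (𝓘 : Order.Ideal (Set I)) (A : Set I) : PowersetQuotient 𝓘 :=
  Quotient.mk (powersetSetoid 𝓘) A

theorem mk_eq_mk {A B : Set I} : mk 𝓘 A = mk 𝓘 B ↔ A ∆ B ∈ 𝓘 :=
  ⟨fun h => Quotient.exact h, fun h => Quotient.sound h⟩

theorem mk_surjective : Function.Surjective (mk 𝓘) :=
  fun a => Quotient.inductionOn a fun A => ⟨A, rfl⟩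

instance : Bot (PowersetQuotient 𝓘) := ⟨mk 𝓘 ∅⟩
instance : Top (PowersetQuotient 𝓘) := ⟨mk 𝓘 Set.univ⟩

instance : Compl (PowersetQuotient 𝓘) :=
  ⟨Quotient.map (fun A => Aᶜ) fun A B (h : A ∆ B ∈ 𝓘) =>
    show Aᶜ ∆ Bᶜ ∈ 𝓘 by rwa [compl_symmDiff_compl]⟩

instance : Min (PowersetQuotient 𝓘) :=
  ⟨Quotient.map₂ (fun A B => A ∩ B) fun A A' (hA : A ∆ A' ∈ 𝓘) B B' (hB : B ∆ B' ∈ 𝓘) =>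
    show (A ∩ B) ∆ (A' ∩ B') ∈ 𝓘 by
      refine 𝓘.lower ?_ (Order.Ideal.sup_mem hA hB)
      intro i
      simp only [Set.mem_symmDiff, Set.mem_inter_iff, Set.sup_eq_union, Set.mem_union]
      tauto⟩

instance : Max (PowersetQuotient 𝓘) :=
  ⟨Quotient.map₂ (fun A B => A ∪ B) fun A A' (hA : A ∆ A' ∈ 𝓘) B B' (hB : B ∆ B' ∈ 𝓘) =>
    show (A ∪ B) ∆ (A' ∪ B') ∈ 𝓘 by
      refine 𝓘.lower ?_ (Order.Ideal.sup_mem hA hB)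
      intro i
      simp only [Set.mem_symmDiff, Set.sup_eq_union, Set.mem_union]
      tauto⟩

theorem mk_inf (A B : Set I) : mk 𝓘 A ⊓ mk 𝓘 B = mk 𝓘 (A ∩ B) := rfl
theorem mk_sup (A B : Set I) : mk 𝓘 A ⊔ mk 𝓘 B = mk 𝓘 (A ∪ B) := rfl
theorem mk_compl (A : Set I) : (mk 𝓘 A)ᶜ = mk 𝓘 Aᶜ := rfl
theorem bot_def : (⊥ : PowersetQuotient 𝓘) = mk 𝓘 ∅ := rfl
theorem top_def : (⊤ : PowersetQuotient 𝓘) = mk 𝓘 Set.univ := rfl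

end PowersetQuotient

/-! ### Reduced products -/

section ReducedProduct

variable {I : Type w} (𝓘 : Order.Ideal (Set I)) (M : I → Type x)

/-- Two families are identified when the set of indices where they differ lies in the ideal. -/
def productSetoid : Setoid (∀ i, M i) where
  r a b := {i | a i ≠ b i} ∈ 𝓘
  iseqv :=
    { refl := fun a => by
        have h : {i | a i ≠ a i} = (⊥ : Set I) := by ext i; simp
        rw [h]; exact 𝓘.bot_mem
      symm := fun {a b} h => by
        have h' : {i | b i ≠ a i} = {i | a i ≠ b i} := by ext i; simp [ne_comm]
        rw [h']; exact h
      trans := fun {a b c} h₁ h₂ => by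
        refine 𝓘.lower ?_ (Order.Ideal.sup_mem h₁ h₂)
        intro i hi
        by_contra hcon
        simp only [Set.sup_eq_union, Set.mem_union, Set.mem_ofPred_eq, not_or, not_not] at hcon
        exact hi (hcon.1.trans hcon.2) }

/-- The universe of the reduced product `∏_𝓘 M i`. -/
def ReducedProduct : Type (max w x) := Quotient (productSetoid 𝓘 M)

variable {M}

/-- The class of a family. -/
def ReducedProduct.mk (a : ∀ i, M i) : ReducedProduct 𝓘 M := Quotient.mk (productSetoid 𝓘 M) a

variable {𝓘}

/-- A representative of an element of the reduced product. -/
noncomputable def ReducedProduct.rep (a : ReducedProduct 𝓘 M) : ∀ i, M i :=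
  Quotient.out (s := productSetoid 𝓘 M) a

theorem ReducedProduct.mk_rep (a : ReducedProduct 𝓘 M) : ReducedProduct.mk 𝓘 a.rep = a :=
  Quotient.out_eq (s := productSetoid 𝓘 M) a

theorem ReducedProduct.mk_eq_mk {a b : ∀ i, M i} :
    ReducedProduct.mk 𝓘 a = ReducedProduct.mk 𝓘 b ↔ {i | a i ≠ b i} ∈ 𝓘 :=
  ⟨fun h => Quotient.exact (s := productSetoid 𝓘 M) h,
    fun h => Quotient.sound (s := productSetoid 𝓘 M) h⟩

/-- Finitely many representatives simultaneously agree with other representatives off a set in the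
ideal. -/
theorem exists_ne_mem {n : ℕ} {a b : Fin n → ∀ i, M i}
    (h : ∀ k, {i | a k i ≠ b k i} ∈ 𝓘) : {i | ∃ k, a k i ≠ b k i} ∈ 𝓘 := by
  induction n with
  | zero =>
    have h' : {i | ∃ k : Fin 0, a k i ≠ b k i} = (⊥ : Set I) := by ext i; simp
    rw [h']; exact 𝓘.bot_mem
  | succ n ih =>
    refine 𝓘.lower ?_ (Order.Ideal.sup_mem (h 0)
      (ih (a := fun k => a k.succ) (b := fun k => b k.succ) fun k => h k.succ))
    rintro i ⟨k, hk⟩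
    induction k using Fin.cases with
    | zero => exact Or.inl hk
    | succ k => exact Or.inr ⟨k, hk⟩

variable {L : FirstOrder.Language.{u, v}} [∀ i, L.Structure (M i)]

instance productPrestructure : L.Prestructure (productSetoid 𝓘 M) :=
  { productSetoid 𝓘 M with
    toStructure :=
      { funMap := fun {_} f a i => Structure.funMap f fun k => a k i
        RelMap := fun {_} R a => {i | ¬ Structure.RelMap R fun k => a k i} ∈ 𝓘 }
    fun_equiv := fun {n} f a b hab => by
      refine 𝓘.lower ?_ (exists_ne_mem (𝓘 := 𝓘) (a := a) (b := b) hab)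
      intro i hi
      by_contra hcon
      refine hi (congrArg (Structure.funMap f) (funext fun k => ?_))
      by_contra hk
      exact hcon ⟨k, hk⟩
    rel_equiv := fun {n} R a b hab => by
      have key : ∀ a b : Fin n → ∀ i, M i, (∀ k, {i | a k i ≠ b k i} ∈ 𝓘) →
          {i | ¬ Structure.RelMap R fun k => a k i} ∈ 𝓘 →
          {i | ¬ Structure.RelMap R fun k => b k i} ∈ 𝓘 := by
        intro a b hab ha
        refine 𝓘.lower ?_ (Order.Ideal.sup_mem ha (exists_ne_mem (𝓘 := 𝓘) hab))
        intro i hi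
        by_cases he : ∃ k, a k i ≠ b k i
        · exact Or.inr he
        · refine Or.inl fun hR => hi ?_
          have : (fun k => a k i) = fun k => b k i :=
            funext fun k => by by_contra hk; exact he ⟨k, hk⟩
          rwa [this] at hR
      exact propext ⟨key a b hab,
        key b a fun k => (productSetoid 𝓘 M).symm (hab k)⟩ }

/-- The `L`-structure of the reduced product. -/
instance reducedProductStructure : L.Structure (ReducedProduct 𝓘 M) :=
  inferInstanceAs (L.Structure (Quotient (productSetoid 𝓘 M)))

theorem funMap_mk {n : ℕ} (f : L.Functions n) (a : Fin n → ∀ i, M i) :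
    Structure.funMap f (fun k => ReducedProduct.mk 𝓘 (a k)) =
      ReducedProduct.mk 𝓘 fun i => Structure.funMap f fun k => a k i :=
  funMap_quotient_mk' (s := productSetoid 𝓘 M) f a

theorem relMap_mk {n : ℕ} (R : L.Relations n) (a : Fin n → ∀ i, M i) :
    Structure.RelMap R (fun k => ReducedProduct.mk 𝓘 (a k)) ↔
      {i | ¬ Structure.RelMap R fun k => a k i} ∈ 𝓘 :=
  relMap_quotient_mk' (s := productSetoid 𝓘 M) R a

/-! ### Support functions -/

/-- The relative support function: the class of the set of coordinates where `a` and `b` agree. -/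
noncomputable def suppEq (a b : ReducedProduct 𝓘 M) : PowersetQuotient 𝓘 :=
  PowersetQuotient.mk 𝓘 {i | a.rep i = b.rep i}

/-- The `φ`-support function: the class of the set of coordinates where `φ` holds. For `n = 0`,
that is for a sentence `φ`, this is the constant `c_φ`. -/
noncomputable def supp {n : ℕ} (φ : L.Formula (Fin n)) (a : Fin n → ReducedProduct 𝓘 M) :
    PowersetQuotient 𝓘 :=
  PowersetQuotient.mk 𝓘 {i | φ.Realize fun k => (a k).rep i}

theorem rep_mk_ne_mem (a : ∀ i, M i) : {i | (ReducedProduct.mk 𝓘 a).rep i ≠ a i} ∈ 𝓘 :=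
  ReducedProduct.mk_eq_mk.1 (ReducedProduct.mk_rep _)

/-- The `φ`-support does not depend on the choice of representatives. -/
theorem supp_mk {n : ℕ} (φ : L.Formula (Fin n)) (a : Fin n → ∀ i, M i) :
    supp φ (fun k => ReducedProduct.mk 𝓘 (a k)) =
      PowersetQuotient.mk 𝓘 {i | φ.Realize fun k => a k i} := by
  refine PowersetQuotient.mk_eq_mk.2 (𝓘.lower ?_
    (exists_ne_mem (𝓘 := 𝓘) fun k => rep_mk_ne_mem (𝓘 := 𝓘) (a k)))
  intro i hi
  by_contra hcon
  have : (fun k => (ReducedProduct.mk 𝓘 (a k)).rep i) = fun k => a k i :=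
    funext fun k => by by_contra hk; exact hcon ⟨k, hk⟩
  simp only [Set.mem_symmDiff, Set.mem_ofPred_eq, this] at hi
  tauto

/-- The relative support does not depend on the choice of representatives. -/
theorem suppEq_mk (a b : ∀ i, M i) :
    suppEq (ReducedProduct.mk 𝓘 a) (ReducedProduct.mk 𝓘 b) =
      PowersetQuotient.mk 𝓘 {i | a i = b i} := by
  refine PowersetQuotient.mk_eq_mk.2 (𝓘.lower ?_
    (Order.Ideal.sup_mem (rep_mk_ne_mem (𝓘 := 𝓘) a) (rep_mk_ne_mem (𝓘 := 𝓘) b)))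
  intro i hi
  by_contra hcon
  simp only [Set.sup_eq_union, Set.mem_union, Set.mem_ofPred_eq, not_or, not_not] at hcon
  simp only [Set.mem_symmDiff, Set.mem_ofPred_eq, hcon.1, hcon.2] at hi
  tauto

end ReducedProduct

/-! ### `h`-formulas and fundamental sets -/

/-- The class of `h`-formulas: it contains the atomic formulas and is closed under
`φ ∧ ψ`, `∃ x φ`, `∀ x φ` and `∃ x φ ∧ ∀ x (φ → ψ)`. -/
inductive IsHFormula {L : FirstOrder.Language.{u, v}} {α : Type w} :
    ∀ {n : ℕ}, L.BoundedFormula α n → Prop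
  | atomic {n : ℕ} {φ : L.BoundedFormula α n} (h : φ.IsAtomic) : IsHFormula φ
  | and {n : ℕ} {φ ψ : L.BoundedFormula α n} (hφ : IsHFormula φ) (hψ : IsHFormula ψ) :
      IsHFormula (φ ⊓ ψ)
  | ex {n : ℕ} {φ : L.BoundedFormula α (n + 1)} (hφ : IsHFormula φ) : IsHFormula φ.ex
  | all {n : ℕ} {φ : L.BoundedFormula α (n + 1)} (hφ : IsHFormula φ) : IsHFormula φ.all
  | exAll {n : ℕ} {φ ψ : L.BoundedFormula α (n + 1)} (hφ : IsHFormula φ) (hψ : IsHFormula ψ) :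
      IsHFormula (φ.ex ⊓ (φ.imp ψ).all)

/-- Boolean combinations, in the variables `x₀, …, xₙ₋₁`, of formulas from `Φ`. A formula
`φ(y₀, …, yₖ₋₁)` of `Φ` may be used with any of the variables `x₀, …, xₙ₋₁` written for its own
variables. (The remaining connectives are abbreviations for expressions in `⊥` and `→`.) -/
inductive IsBooleanCombination {L : FirstOrder.Language.{u, v}} (Φ : ∀ n, Set (L.Formula (Fin n))) {n : ℕ} :
    L.Formula (Fin n) → Prop
  | mem {k : ℕ} {φ : L.Formula (Fin k)} (hφ : φ ∈ Φ k) (σ : Fin k → Fin n) :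
      IsBooleanCombination Φ (φ.relabel σ)
  | falsum : IsBooleanCombination Φ ⊥
  | imp {φ ψ : L.Formula (Fin n)} (hφ : IsBooleanCombination Φ φ)
      (hψ : IsBooleanCombination Φ ψ) : IsBooleanCombination Φ (φ.imp ψ)

section Fundamental

variable {L : FirstOrder.Language.{u, v}} {I : Type w} (𝓘 : Order.Ideal (Set I)) (M : I → Type x)
  [∀ i, L.Structure (M i)]

/-- The common theory `Th_𝓘(M i)` of `M i` for all but `𝓘`-many `i`. -/
def relativeTheory : L.Theory := {θ | {i | ¬ M i ⊨ θ} ∈ 𝓘}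

/-- Equivalence of formulas in `Th_𝓘(M i)`: the sentence `∀ x̄ (φ ↔ ψ)` belongs to it. -/
def EquivModulo {n : ℕ} (φ ψ : L.Formula (Fin n)) : Prop :=
  Formula.iAlls (Fin n) ((φ.iff ψ).relabel (Sum.inr : Fin n → Empty ⊕ Fin n)) ∈
    relativeTheory (L := L) 𝓘 M

/-- The meaning of equivalence in `Th_𝓘(M i)`. -/
theorem equivModulo_iff {n : ℕ} (φ ψ : L.Formula (Fin n)) :
    EquivModulo 𝓘 M φ ψ ↔
      {i | ¬ ∀ a : Fin n → M i, φ.Realize a ↔ ψ.Realize a} ∈ 𝓘 := by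
  have h : {i | ¬ M i ⊨ Formula.iAlls (Fin n)
        ((φ.iff ψ).relabel (Sum.inr : Fin n → Empty ⊕ Fin n))} =
      {i | ¬ ∀ a : Fin n → M i, φ.Realize a ↔ ψ.Realize a} := by
    ext i
    simp [Sentence.Realize, Formula.realize_iAlls, Function.comp_def]
  unfold EquivModulo relativeTheory
  rw [Set.mem_ofPred_eq, h]

/-- `Φ` is fundamental for `(M i)` and `𝓘`: every formula is equivalent in `Th_𝓘(M i)` to a
Boolean combination of formulas from `Φ`. -/
def IsFundamental (Φ : ∀ n, Set (L.Formula (Fin n))) : Prop :=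
  ∀ (n : ℕ) (ψ : L.Formula (Fin n)),
    ∃ β : L.Formula (Fin n), IsBooleanCombination Φ β ∧ EquivModulo 𝓘 M ψ β

end Fundamental

/-! ### Interpretations of the quotient Boolean algebra -/

/-- The data of a presentation of `P(I)/𝓘` as a quotient of a set of tuples of the reduced
product: a set `dom` of `dim`-tuples and a surjection of `dom` onto `P(I)/𝓘`. -/
structure Coding {I : Type w} (𝓘 : Order.Ideal (Set I)) (M : I → Type x) where
  dim : ℕ
  dom : Set (Fin dim → ReducedProduct 𝓘 M)
  proj : dom → PowersetQuotient 𝓘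
  surjective_proj : Function.Surjective proj

namespace Coding

variable {I : Type w} {𝓘 : Order.Ideal (Set I)} {M : I → Type x} (c : Coding 𝓘 M)

/-- The pullback, along the surjection, of a relation between `p` elements of the reduced product
and `q` elements of `P(I)/𝓘`. -/
def pullback {p q : ℕ}
    (R : (Fin p → ReducedProduct 𝓘 M) → (Fin q → PowersetQuotient 𝓘) → Prop) :
    Set (Fin p ⊕ Fin q × Fin c.dim → ReducedProduct 𝓘 M) :=
  {z | ∃ h : ∀ j, (fun l => z (Sum.inr (j, l))) ∈ c.dom,
    R (fun k => z (Sum.inl k)) fun j => c.proj ⟨_, h j⟩}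

/-- A relation between elements of the reduced product and of `P(I)/𝓘` is interpreted over `A`
when its pullback is definable in the `L`-structure `∏_𝓘 M i` with parameters from `A`. -/
def Interprets (L : FirstOrder.Language.{u, v}) [∀ i, L.Structure (M i)] (A : Set (ReducedProduct 𝓘 M))
    {p q : ℕ} (R : (Fin p → ReducedProduct 𝓘 M) → (Fin q → PowersetQuotient 𝓘) → Prop) : Prop :=
  A.Definable L (c.pullback R)

/-- A function from tuples of the reduced product to `P(I)/𝓘` is interpreted when its graph is. -/
def InterpretsFunction (L : FirstOrder.Language.{u, v}) [∀ i, L.Structure (M i)]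
    (A : Set (ReducedProduct 𝓘 M)) {p : ℕ}
    (f : (Fin p → ReducedProduct 𝓘 M) → PowersetQuotient 𝓘) : Prop :=
  c.Interprets L A (q := 1) fun a X => f a = X 0

/-- The coding is an interpretation over `A` of the Boolean algebra `P(I)/𝓘` in `∏_𝓘 M i`. -/
structure IsInterpretation (L : FirstOrder.Language.{u, v}) [∀ i, L.Structure (M i)]
    (A : Set (ReducedProduct 𝓘 M)) : Prop where
  dom : A.Definable L c.dom
  eq : c.Interprets L A (p := 0) (q := 2) fun _ X => X 0 = X 1
  bot : c.Interprets L A (p := 0) (q := 1) fun _ X => X 0 = ⊥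
  top : c.Interprets L A (p := 0) (q := 1) fun _ X => X 0 = ⊤
  compl : c.Interprets L A (p := 0) (q := 2) fun _ X => (X 0)ᶜ = X 1
  inf : c.Interprets L A (p := 0) (q := 3) fun _ X => X 0 ⊓ X 1 = X 2
  sup : c.Interprets L A (p := 0) (q := 3) fun _ X => X 0 ⊔ X 1 = X 2

end Coding

/-! ### The two-sorted Feferman–Vaught language and its fragments

For a set `Φ` of `L`-formulas, the language has a main sort carrying the language `L`, a Boolean
sort carrying the language `∩, ∪, 0, 1, ᶜ` of Boolean algebras, function symbols `supp_φ` from the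
main sort to the Boolean sort for `φ ∈ Φ`, and constants `c_θ` of the Boolean sort for the
sentences `θ ∈ Φ` (these are the symbols `supp_θ` without arguments). The full Feferman–Vaught
language is the case where `Φ` consists of all formulas. -/

section TwoSorted

variable {L : FirstOrder.Language.{u, v}} (Φ : ∀ n, Set (L.Formula (Fin n)))

/-- Terms of the Boolean sort in `m` main variables and `k` Boolean variables. (Terms of the main
sort are the `L`-terms, as no function symbol goes from the Boolean sort to the main sort.) -/
inductive BoolTerm (m k : ℕ) : Type (max u v)
  | var (j : Fin k) : BoolTerm m k
  | supp {n : ℕ} (φ : L.Formula (Fin n)) (hφ : φ ∈ Φ n) (t : Fin n → L.Term (Fin m)) :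
      BoolTerm m k
  | bot : BoolTerm m k
  | top : BoolTerm m k
  | compl (s : BoolTerm m k) : BoolTerm m k
  | inf (s t : BoolTerm m k) : BoolTerm m k
  | sup (s t : BoolTerm m k) : BoolTerm m k

/-- Two-sorted formulas with free variables among `m` main variables and `k` Boolean variables.
A quantifier binds the last variable of its sort. (The remaining connectives and the existential
quantifiers are abbreviations.) -/
inductive TwoSortedFormula : ℕ → ℕ → Type (max u v)
  | falsum {m k : ℕ} : TwoSortedFormula m k
  | eqMain {m k : ℕ} (s t : L.Term (Fin m)) : TwoSortedFormula m k
  | rel {m k l : ℕ} (R : L.Relations l) (t : Fin l → L.Term (Fin m)) : TwoSortedFormula m k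
  | eqBool {m k : ℕ} (s t : BoolTerm Φ m k) : TwoSortedFormula m k
  | imp {m k : ℕ} (χ₁ χ₂ : TwoSortedFormula m k) : TwoSortedFormula m k
  | allMain {m k : ℕ} (χ : TwoSortedFormula (m + 1) k) : TwoSortedFormula m k
  | allBool {m k : ℕ} (χ : TwoSortedFormula m (k + 1)) : TwoSortedFormula m k

variable {Φ}

/-- The formulas `ψ(s₁, …, s_r)` where `ψ` is a formula of the language of the Boolean sort and
`s₁, …, s_r` are terms of the Boolean sort: they are built from equations between Boolean terms by
connectives and by quantifiers over the Boolean sort. -/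
inductive TwoSortedFormula.IsBoolean : ∀ {m k : ℕ}, TwoSortedFormula Φ m k → Prop
  | falsum {m k : ℕ} : IsBoolean (.falsum : TwoSortedFormula Φ m k)
  | eqBool {m k : ℕ} (s t : BoolTerm Φ m k) : IsBoolean (.eqBool s t)
  | imp {m k : ℕ} {χ₁ χ₂ : TwoSortedFormula Φ m k} (h₁ : IsBoolean χ₁) (h₂ : IsBoolean χ₂) :
      IsBoolean (.imp χ₁ χ₂)
  | allBool {m k : ℕ} {χ : TwoSortedFormula Φ m (k + 1)} (h : IsBoolean χ) :
      IsBoolean (.allBool χ)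

/-- The formulas that are quantifier-free relative to the Boolean sort, that is, quantifier-free
after every formula of the language of the Boolean sort has been named by a predicate: Boolean
combinations of atomic formulas and of formulas `ψ(s₁, …, s_r)` as above. -/
inductive TwoSortedFormula.IsRelQuantifierFree {m k : ℕ} : TwoSortedFormula Φ m k → Prop
  | eqMain (s t : L.Term (Fin m)) : IsRelQuantifierFree (.eqMain s t)
  | rel {l : ℕ} (R : L.Relations l) (t : Fin l → L.Term (Fin m)) : IsRelQuantifierFree (.rel R t)
  | boolean {χ : TwoSortedFormula Φ m k} (h : χ.IsBoolean) : IsRelQuantifierFree χ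
  | imp {χ₁ χ₂ : TwoSortedFormula Φ m k} (h₁ : IsRelQuantifierFree χ₁)
      (h₂ : IsRelQuantifierFree χ₂) : IsRelQuantifierFree (.imp χ₁ χ₂)

variable {I : Type w} {𝓘 : Order.Ideal (Set I)} {M : I → Type x} [∀ i, L.Structure (M i)]

/-- The value of a Boolean term in the two-sorted structure `(∏_𝓘 M i, P(I)/𝓘)`. -/
noncomputable def BoolTerm.realize {m k : ℕ} (a : Fin m → ReducedProduct 𝓘 M)
    (X : Fin k → PowersetQuotient 𝓘) : BoolTerm Φ m k → PowersetQuotient 𝓘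
  | .var j => X j
  | .supp φ _ t => FV.supp φ fun l => (t l).realize a
  | .bot => ⊥
  | .top => ⊤
  | .compl s => (s.realize a X)ᶜ
  | .inf s t => s.realize a X ⊓ t.realize a X
  | .sup s t => s.realize a X ⊔ t.realize a X

/-- Truth of a two-sorted formula in the two-sorted structure `(∏_𝓘 M i, P(I)/𝓘)`. -/
def TwoSortedFormula.Realize : ∀ {m k : ℕ}, TwoSortedFormula Φ m k →
    (Fin m → ReducedProduct 𝓘 M) → (Fin k → PowersetQuotient 𝓘) → Prop
  | _, _, .falsum, _, _ => False
  | _, _, .eqMain s t, a, _ => s.realize a = t.realize a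
  | _, _, .rel R t, a, _ => Structure.RelMap R fun l => (t l).realize a
  | _, _, .eqBool s t, a, X => s.realize a X = t.realize a X
  | _, _, .imp χ₁ χ₂, a, X => χ₁.Realize a X → χ₂.Realize a X
  | _, _, .allMain χ, a, X =>
      ∀ b : ReducedProduct 𝓘 M, χ.Realize (Fin.snoc (α := fun _ => ReducedProduct 𝓘 M) a b) X
  | _, _, .allBool χ, a, X =>
      ∀ Y : PowersetQuotient 𝓘, χ.Realize a (Fin.snoc (α := fun _ => PowersetQuotient 𝓘) X Y)

variable (Φ 𝓘 M)

/-- The reduced product eliminates quantifiers relative to `P(I)/𝓘` in the two-sorted language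
given by `Φ`: every formula is equivalent, in the two-sorted structure `(∏_𝓘 M i, P(I)/𝓘)`, to a
formula with the same free variables that is quantifier-free relative to the Boolean sort. -/
def EliminatesQuantifiersRelative : Prop :=
  ∀ (m k : ℕ) (χ : TwoSortedFormula Φ m k), ∃ χ' : TwoSortedFormula Φ m k,
    χ'.IsRelQuantifierFree ∧
      ∀ (a : Fin m → ReducedProduct 𝓘 M) (X : Fin k → PowersetQuotient 𝓘),
        χ.Realize a X ↔ χ'.Realize a X

end TwoSorted

end FV

/-! Write "almost all `i`" for: all `i` outside a set in the ideal.

Interpretation of supports. The support of a relation `S` at `a` is the largest `X` in `P(I)/𝓘`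
below it, so it suffices to express `X ≤ supp_S(a)`. Suppose some tuple `e` satisfies `S` in almost
all coordinates. Then `X ≤ supp_S(a)` holds exactly when some `b` satisfies `S` in almost all
coordinates and agrees with `a` on `X`: glue `a` on `X` to `e` off `X` (`exists_agree_iff`).
Agreement on `X` is expressed by `supp_=`, so `supp_S` is interpreted as soon as the set of tuples
satisfying `S` in almost all coordinates is definable and nonempty (`interprets_supportOn`). For an
`h`-formula this set is the one the formula itself defines in the reduced product
(`IsHFormula.realize_iff`). If the formulas of `Φ` are satisfiable, their supports are therefore
interpreted, and fundamentality reduces every other support to Boolean operations on these. If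
instead the relation symbols have nonempty interpretations, the gluing argument applies to them, and
one inducts on formulas: the support of `∀ y φ` at `a` is the least of the supports of `φ` at `(a,
b)`, attained at a `b` that picks a counterexample wherever there is one.

Elimination. By induction, every two-sorted formula is equivalent to a formula of the Boolean
algebra about the supports of `L`-formulas at the main variables (`exists_boolLanguage_formula`).
For a quantifier over `b` in the main sort, only the finite tuple `Y` of supports of some `f j` at
`(a, b)` matters. A tuple `Y` arises from some `b` exactly when, for every pattern `S`, the atom of
`Y` given by `S` lies below the support at `a` of "some `y` makes exactly the `f j` with `j ∈ S`
true" (`exists_supp_snoc_eq_iff`). The quantifier over `b` thus becomes one over `Y`. Fundamentality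
finally turns each support into a Boolean term over `Φ`. -/

namespace FV

open FirstOrder FirstOrder.Language Filter

/-! ### The filter of sets with complement in the ideal -/

section Cofilter

variable {I : Type w} (𝓘 : Order.Ideal (Set I))

/-- The filter of sets whose complement lies in the ideal. -/
def cofilter : Filter I where
  sets := {s | sᶜ ∈ 𝓘}
  univ_sets := by
    have h : (Set.univ : Set I)ᶜ = ⊥ := by simp
    show (Set.univ : Set I)ᶜ ∈ 𝓘
    rw [h]; exact 𝓘.bot_mem
  sets_of_superset := fun {s t} hs hst => 𝓘.lower (Set.compl_subset_compl.2 hst) hs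
  inter_sets := fun {s t} hs ht => by
    show (s ∩ t)ᶜ ∈ 𝓘
    rw [Set.compl_inter]
    exact Order.Ideal.sup_mem hs ht

theorem eventually_cofilter {p : I → Prop} : (∀ᶠ i in cofilter 𝓘, p i) ↔ {i | ¬ p i} ∈ 𝓘 :=
  Iff.rfl

variable {𝓘}

theorem PowersetQuotient.mk_eq_mk_iff {A B : Set I} :
    PowersetQuotient.mk 𝓘 A = PowersetQuotient.mk 𝓘 B ↔ ∀ᶠ i in cofilter 𝓘, i ∈ A ↔ i ∈ B := by
  rw [PowersetQuotient.mk_eq_mk, eventually_cofilter]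
  have h : symmDiff A B = {i | ¬ (i ∈ A ↔ i ∈ B)} := by
    ext i
    simp only [Set.mem_symmDiff, Set.mem_ofPred_eq]
    tauto
  rw [h]

theorem PowersetQuotient.mk_inf_eq_left {A B : Set I} :
    PowersetQuotient.mk 𝓘 A ⊓ PowersetQuotient.mk 𝓘 B = PowersetQuotient.mk 𝓘 A ↔
      ∀ᶠ i in cofilter 𝓘, i ∈ A → i ∈ B := by
  rw [PowersetQuotient.mk_inf, PowersetQuotient.mk_eq_mk_iff]
  refine eventually_congr (Eventually.of_forall fun i => ?_)
  simp

theorem PowersetQuotient.mk_eq_top {A : Set I} :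
    PowersetQuotient.mk 𝓘 A = ⊤ ↔ ∀ᶠ i in cofilter 𝓘, i ∈ A := by
  rw [PowersetQuotient.top_def, PowersetQuotient.mk_eq_mk_iff]
  simp

variable {M : I → Type x}

theorem ReducedProduct.rep_mk (a : ∀ i, M i) :
    ∀ᶠ i in cofilter 𝓘, (ReducedProduct.mk 𝓘 a).rep i = a i :=
  rep_mk_ne_mem a

theorem ReducedProduct.eq_iff {a b : ReducedProduct 𝓘 M} :
    a = b ↔ ∀ᶠ i in cofilter 𝓘, a.rep i = b.rep i := by
  conv_lhs => rw [← a.mk_rep, ← b.mk_rep, ReducedProduct.mk_eq_mk]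
  rfl

/-- Coordinatewise choice of an element of the reduced product. -/
theorem ReducedProduct.exists_forall_of_eventually {p : ∀ i, M i → Prop} [∀ i, Nonempty (M i)] :
    ∃ b : ReducedProduct 𝓘 M, ∀ᶠ i in cofilter 𝓘, (∃ y, p i y) → p i (b.rep i) := by
  classical
  refine ⟨ReducedProduct.mk 𝓘 fun i => Classical.epsilon (p i), ?_⟩
  filter_upwards [ReducedProduct.rep_mk (𝓘 := 𝓘) fun i => Classical.epsilon (p i)] with i hi h
  rw [hi]
  exact Classical.epsilon_spec h

theorem ReducedProduct.rep_snoc {n : ℕ} (a : Fin n → ReducedProduct 𝓘 M)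
    (b : ReducedProduct 𝓘 M) (i : I) :
    (fun k => (Fin.snoc (α := fun _ => ReducedProduct 𝓘 M) a b k).rep i) =
      Fin.snoc (α := fun _ => M i) (fun k => (a k).rep i) (b.rep i) := by
  funext k
  refine Fin.lastCases ?_ (fun k => ?_) k <;> simp

end Cofilter

/-! ### Truth in the reduced product -/

section Realize

variable {I : Type w} {𝓘 : Order.Ideal (Set I)} {M : I → Type x}
  {L : FirstOrder.Language.{u, v}} [∀ i, L.Structure (M i)]

theorem rep_funMap {n : ℕ} (f : L.Functions n) (a : Fin n → ReducedProduct 𝓘 M) :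
    ∀ᶠ i in cofilter 𝓘,
      (Structure.funMap f a).rep i = Structure.funMap f fun k => (a k).rep i := by
  have h : a = fun k => ReducedProduct.mk 𝓘 (a k).rep := funext fun k => (a k).mk_rep.symm
  conv in Structure.funMap f a => rw [h, funMap_mk]
  exact ReducedProduct.rep_mk _

theorem relMap_iff {n : ℕ} (R : L.Relations n) (a : Fin n → ReducedProduct 𝓘 M) :
    Structure.RelMap R a ↔ ∀ᶠ i in cofilter 𝓘, Structure.RelMap R fun k => (a k).rep i := by
  have h : a = fun k => ReducedProduct.mk 𝓘 (a k).rep := funext fun k => (a k).mk_rep.symm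
  conv_lhs => rw [h, relMap_mk]
  rfl

theorem rep_realize {α : Type*} (t : L.Term α) (a : α → ReducedProduct 𝓘 M) :
    ∀ᶠ i in cofilter 𝓘, (t.realize a).rep i = t.realize fun k => (a k).rep i := by
  induction t with
  | var k => simp
  | func f ts ih =>
    filter_upwards [rep_funMap f fun k => (ts k).realize a, eventually_all.2 ih] with i h₁ h₂
    simp only [Term.realize_func, h₁, h₂]

theorem rep_realize_all {α β : Type*} [Finite β] (t : β → L.Term α)
    (a : α → ReducedProduct 𝓘 M) :
    ∀ᶠ i in cofilter 𝓘, (fun j => ((t j).realize a).rep i) =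
      fun j => (t j).realize fun k => (a k).rep i := by
  filter_upwards [eventually_all.2 fun j => rep_realize (t j) a] with i h
  exact funext h

/-- `h`-formulas hold in the reduced product exactly when they hold in almost all coordinates. -/
theorem IsHFormula.realize_iff [∀ i, Nonempty (M i)] {α : Type*} {n : ℕ}
    {φ : L.BoundedFormula α n} (hφ : IsHFormula φ) (v : α → ReducedProduct 𝓘 M)
    (xs : Fin n → ReducedProduct 𝓘 M) :
    φ.Realize v xs ↔
      ∀ᶠ i in cofilter 𝓘, φ.Realize (fun k => (v k).rep i) fun k => (xs k).rep i := by
  have helim : ∀ {n : ℕ} (xs : Fin n → ReducedProduct 𝓘 M) (i : I),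
      (fun k => (Sum.elim v xs k).rep i) =
        Sum.elim (fun k => (v k).rep i) fun k => (xs k).rep i := by
    intro n xs i
    funext k
    cases k <;> rfl
  induction hφ with
  | atomic h =>
    cases h with
    | equal s t =>
      rw [BoundedFormula.realize_bdEqual, ReducedProduct.eq_iff]
      refine eventually_congr ?_
      filter_upwards [rep_realize s (Sum.elim v xs), rep_realize t (Sum.elim v xs)] with i hs ht
      rw [BoundedFormula.realize_bdEqual, hs, ht, helim]
    | rel R ts =>
      rw [BoundedFormula.realize_rel, relMap_iff]
      refine eventually_congr ?_
      filter_upwards [rep_realize_all ts (Sum.elim v xs)] with i h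
      rw [BoundedFormula.realize_rel, h, helim]
  | and _ _ ih₁ ih₂ => simp only [BoundedFormula.realize_inf, ih₁, ih₂, eventually_and]
  | @ex n φ _ ih =>
    simp only [BoundedFormula.realize_ex, ih, ReducedProduct.rep_snoc]
    refine ⟨fun ⟨b, hb⟩ => hb.mono fun i hi => ⟨_, hi⟩, fun h => ?_⟩
    obtain ⟨b, hb⟩ := ReducedProduct.exists_forall_of_eventually (𝓘 := 𝓘) (p := fun i y =>
      φ.Realize (fun k => (v k).rep i) (Fin.snoc (fun k => (xs k).rep i) y))
    exact ⟨b, hb.mp (h.mono fun i h₁ h₂ => h₂ h₁)⟩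
  | @all n φ _ ih =>
    simp only [BoundedFormula.realize_all, ih, ReducedProduct.rep_snoc]
    refine ⟨fun h => ?_, fun h b => h.mono fun i hi => hi _⟩
    -- A single element collects a counterexample from every coordinate that has one.
    obtain ⟨b, hb⟩ := ReducedProduct.exists_forall_of_eventually (𝓘 := 𝓘) (p := fun i y =>
      ¬ φ.Realize (fun k => (v k).rep i) (Fin.snoc (fun k => (xs k).rep i) y))
    filter_upwards [hb, h b] with i h₁ h₂
    by_contra! hcon
    exact h₁ hcon h₂
  | @exAll n φ ψ _ _ ih₁ ih₂ =>
    simp only [BoundedFormula.realize_inf, BoundedFormula.realize_ex, BoundedFormula.realize_all,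
      BoundedFormula.realize_imp, ih₁, ih₂, ReducedProduct.rep_snoc]
    constructor
    · rintro ⟨⟨e, he⟩, h⟩
      -- `b` satisfies `φ` wherever this is possible, and is a counterexample to `φ → ψ` wherever
      -- one exists. The clause `∃ x φ` is what makes `φ` hold at `b` in almost all coordinates,
      -- including those without a counterexample. The hypothesis then gives `ψ` at `b` in almost
      -- all coordinates, so counterexamples almost never exist.
      obtain ⟨b, hb⟩ := ReducedProduct.exists_forall_of_eventually (𝓘 := 𝓘) (p := fun i y =>
        φ.Realize (fun k => (v k).rep i) (Fin.snoc (fun k => (xs k).rep i) y) ∧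
        ((∃ z, φ.Realize (fun k => (v k).rep i) (Fin.snoc (fun k => (xs k).rep i) z) ∧
            ¬ ψ.Realize (fun k => (v k).rep i) (Fin.snoc (fun k => (xs k).rep i) z)) →
          ¬ ψ.Realize (fun k => (v k).rep i) (Fin.snoc (fun k => (xs k).rep i) y)))
      have key : ∀ᶠ i in cofilter 𝓘,
          φ.Realize (fun k => (v k).rep i) (Fin.snoc (fun k => (xs k).rep i) (b.rep i)) ∧
          ((∃ z, φ.Realize (fun k => (v k).rep i) (Fin.snoc (fun k => (xs k).rep i) z) ∧
            ¬ ψ.Realize (fun k => (v k).rep i) (Fin.snoc (fun k => (xs k).rep i) z)) →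
          ¬ ψ.Realize (fun k => (v k).rep i) (Fin.snoc (fun k => (xs k).rep i) (b.rep i))) := by
        filter_upwards [hb, he] with i h₁ h₂
        apply h₁
        by_cases hz : ∃ z, φ.Realize (fun k => (v k).rep i) (Fin.snoc (fun k => (xs k).rep i) z) ∧
            ¬ ψ.Realize (fun k => (v k).rep i) (Fin.snoc (fun k => (xs k).rep i) z)
        · obtain ⟨z, hz₁, hz₂⟩ := hz
          exact ⟨z, hz₁, fun _ => hz₂⟩
        · exact ⟨_, h₂, fun h => absurd h hz⟩
      filter_upwards [key, h b (key.mono fun i hi => hi.1)] with i h₁ h₂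
      refine ⟨⟨_, h₁.1⟩, fun y hy => ?_⟩
      by_contra hcon
      exact h₁.2 ⟨y, hy, hcon⟩ h₂
    · intro h
      constructor
      · obtain ⟨b, hb⟩ := ReducedProduct.exists_forall_of_eventually (𝓘 := 𝓘) (p := fun i y =>
          φ.Realize (fun k => (v k).rep i) (Fin.snoc (fun k => (xs k).rep i) y))
        exact ⟨b, hb.mp (h.mono fun i h₁ h₂ => h₂ h₁.1)⟩
      · intro b hb
        filter_upwards [h, hb] with i h₁ h₂
        exact h₁.2 _ h₂

theorem IsHFormula.formula_realize_iff [∀ i, Nonempty (M i)] {α : Type*}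
    {φ : L.Formula α} (hφ : IsHFormula φ) (v : α → ReducedProduct 𝓘 M) :
    φ.Realize v ↔ ∀ᶠ i in cofilter 𝓘, φ.Realize fun k => (v k).rep i := by
  refine (hφ.realize_iff v default).trans (eventually_congr (Eventually.of_forall fun i => ?_))
  exact iff_of_eq (congrArg (BoundedFormula.Realize φ _) (Subsingleton.elim _ _))

end Realize

/-! ### Interpreted relations -/

namespace Coding

variable {I : Type w} {𝓘 : Order.Ideal (Set I)} {M : I → Type x} (c : Coding 𝓘 M)
  (L : FirstOrder.Language.{u, v}) [∀ i, L.Structure (M i)] (A : Set (ReducedProduct 𝓘 M))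

/-- The pullback of a relation between tuples indexed by arbitrary types. -/
def pullbackOn {α β : Type*} (R : (α → ReducedProduct 𝓘 M) → (β → PowersetQuotient 𝓘) → Prop) :
    Set (α ⊕ β × Fin c.dim → ReducedProduct 𝓘 M) :=
  {z | ∃ h : ∀ j, (fun l => z (Sum.inr (j, l))) ∈ c.dom,
    R (fun k => z (Sum.inl k)) fun j => c.proj ⟨_, h j⟩}

/-- A relation between tuples indexed by arbitrary types is interpreted when its pullback is
definable. -/
def InterpretsOn {α β : Type*}
    (R : (α → ReducedProduct 𝓘 M) → (β → PowersetQuotient 𝓘) → Prop) : Prop :=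
  A.Definable L (c.pullbackOn R)

variable {c L A} {α α' β β' γ : Type*}

theorem interpretsOn_of_interprets {p q : ℕ}
    {R : (Fin p → ReducedProduct 𝓘 M) → (Fin q → PowersetQuotient 𝓘) → Prop}
    (h : c.Interprets L A R) : c.InterpretsOn L A R := h

namespace InterpretsOn

/-- A pullback contains only tuples whose Boolean entries are codes. Complements, dummy Boolean
variables and empty conjunctions have to be cut back to this set. -/
theorem definable_tuples_dom (hc : A.Definable L c.dom) [Finite β] :
    A.Definable L {z : α ⊕ β × Fin c.dim → ReducedProduct 𝓘 M |
      ∀ j, (fun l => z (Sum.inr (j, l))) ∈ c.dom} := by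
  have h : {z : α ⊕ β × Fin c.dim → ReducedProduct 𝓘 M |
      ∀ j, (fun l => z (Sum.inr (j, l))) ∈ c.dom} =
      ⋂ j, (fun z => z ∘ fun l => Sum.inr (j, l)) ⁻¹' c.dom := by
    ext z
    simp only [Set.mem_ofPred_eq, Set.mem_iInter, Set.mem_preimage, Function.comp_def]
  rw [h]
  exact Set.definable_iInter_of_finite fun j => hc.preimage_comp _

theorem congr {R R' : (α → ReducedProduct 𝓘 M) → (β → PowersetQuotient 𝓘) → Prop}
    (h : c.InterpretsOn L A R) (hR : ∀ a X, R' a X ↔ R a X) : c.InterpretsOn L A R' := by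
  have : R' = R := by
    funext a X
    exact propext (hR a X)
  rwa [this]

theorem reindex (hc : A.Definable L c.dom) [Finite β']
    {R : (α → ReducedProduct 𝓘 M) → (β → PowersetQuotient 𝓘) → Prop}
    (h : c.InterpretsOn L A R) (f : α → α') (g : β → β') :
    c.InterpretsOn L A fun (a : α' → ReducedProduct 𝓘 M) X =>
      R (fun k => a (f k)) fun j => X (g j) := by
  have h' : c.pullbackOn (fun (a : α' → ReducedProduct 𝓘 M) (X : β' → PowersetQuotient 𝓘) =>
      R (fun k => a (f k)) fun j => X (g j)) =
      {z | ∀ j, (fun l => z (Sum.inr (j, l))) ∈ c.dom} ∩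
      (fun z => z ∘ Sum.map f (Prod.map g id)) ⁻¹' c.pullbackOn R := by
    ext z
    exact ⟨fun ⟨h₁, h₂⟩ => ⟨h₁, ⟨fun j => h₁ (g j), h₂⟩⟩, fun ⟨h₁, ⟨_, h₂⟩⟩ => ⟨h₁, h₂⟩⟩
  unfold InterpretsOn
  rw [h']
  exact (definable_tuples_dom hc).inter (h.preimage_comp _)

theorem of_definable (hc : A.Definable L c.dom) [Finite β]
    {s : Set (α → ReducedProduct 𝓘 M)} (hs : A.Definable L s) :
    c.InterpretsOn L A fun a (_ : β → PowersetQuotient 𝓘) => a ∈ s := by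
  have h' : c.pullbackOn (fun a (_ : β → PowersetQuotient 𝓘) => a ∈ s) =
      {z | ∀ j, (fun l => z (Sum.inr (j, l))) ∈ c.dom} ∩ (fun z => z ∘ Sum.inl) ⁻¹' s := by
    ext z
    exact ⟨fun ⟨h₁, h₂⟩ => ⟨h₁, h₂⟩, fun ⟨h₁, h₂⟩ => ⟨h₁, h₂⟩⟩
  unfold InterpretsOn
  rw [h']
  exact (definable_tuples_dom hc).inter (hs.preimage_comp _)

theorem not (hc : A.Definable L c.dom) [Finite β]
    {R : (α → ReducedProduct 𝓘 M) → (β → PowersetQuotient 𝓘) → Prop}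
    (h : c.InterpretsOn L A R) : c.InterpretsOn L A fun a X => ¬ R a X := by
  have h' : c.pullbackOn (fun a X => ¬ R a X) =
      {z | ∀ j, (fun l => z (Sum.inr (j, l))) ∈ c.dom} ∩ (c.pullbackOn R)ᶜ := by
    ext z
    exact ⟨fun ⟨h₁, h₂⟩ => ⟨h₁, fun ⟨_, h₃⟩ => h₂ h₃⟩,
      fun ⟨h₁, h₂⟩ => ⟨h₁, fun h₃ => h₂ ⟨h₁, h₃⟩⟩⟩
  unfold InterpretsOn
  rw [h']
  exact (definable_tuples_dom hc).inter h.compl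

theorem and {R R' : (α → ReducedProduct 𝓘 M) → (β → PowersetQuotient 𝓘) → Prop}
    (h : c.InterpretsOn L A R) (h' : c.InterpretsOn L A R') :
    c.InterpretsOn L A fun a X => R a X ∧ R' a X := by
  have h' : c.pullbackOn (fun a X => R a X ∧ R' a X) = c.pullbackOn R ∩ c.pullbackOn R' := by
    ext z
    exact ⟨fun ⟨h₁, h₂, h₃⟩ => ⟨⟨h₁, h₂⟩, ⟨h₁, h₃⟩⟩, fun ⟨⟨h₁, h₂⟩, ⟨_, h₃⟩⟩ => ⟨h₁, h₂, h₃⟩⟩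
  unfold InterpretsOn
  rw [h']
  exact Set.Definable.inter ‹_› ‹_›

theorem imp (hc : A.Definable L c.dom) [Finite β]
    {R R' : (α → ReducedProduct 𝓘 M) → (β → PowersetQuotient 𝓘) → Prop}
    (h : c.InterpretsOn L A R) (h' : c.InterpretsOn L A R') :
    c.InterpretsOn L A fun a X => R a X → R' a X :=
  ((h.and (h'.not hc)).not hc).congr fun a X => by tauto

theorem forall_of_finite (hc : A.Definable L c.dom) [Finite β] [Finite γ]
    {R : γ → (α → ReducedProduct 𝓘 M) → (β → PowersetQuotient 𝓘) → Prop}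
    (h : ∀ k, c.InterpretsOn L A (R k)) : c.InterpretsOn L A fun a X => ∀ k, R k a X := by
  -- The first factor matters when `γ` is empty.
  have h' : c.pullbackOn (fun a X => ∀ k, R k a X) =
      {z | ∀ j, (fun l => z (Sum.inr (j, l))) ∈ c.dom} ∩ ⋂ k, c.pullbackOn (R k) := by
    ext z
    simp only [Set.mem_inter_iff, Set.mem_iInter]
    exact ⟨fun ⟨h₁, h₂⟩ => ⟨h₁, fun k => ⟨h₁, h₂ k⟩⟩, fun ⟨h₁, h₂⟩ => ⟨h₁, fun k => (h₂ k).2⟩⟩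
  unfold InterpretsOn
  rw [h']
  exact (definable_tuples_dom hc).inter (Set.definable_iInter_of_finite h)

theorem exists_main [Finite α] [Finite β] [Finite γ]
    {R : (α → ReducedProduct 𝓘 M) → (γ → ReducedProduct 𝓘 M) →
      (β → PowersetQuotient 𝓘) → Prop}
    (h : c.InterpretsOn L A fun (a : α ⊕ γ → ReducedProduct 𝓘 M) X =>
      R (fun k => a (Sum.inl k)) (fun k => a (Sum.inr k)) X) :
    c.InterpretsOn L A fun a X => ∃ b, R a b X := by
  have h' := Set.Definable.image_comp h
    (Sum.map Sum.inl id : α ⊕ β × Fin c.dim → (α ⊕ γ) ⊕ β × Fin c.dim)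
  unfold InterpretsOn
  convert h' using 1
  ext z
  constructor
  · rintro ⟨h₁, b, h₂⟩
    refine ⟨Sum.elim (Sum.elim (fun k => z (Sum.inl k)) b) fun l => z (Sum.inr l), ⟨h₁, h₂⟩, ?_⟩
    funext k
    rcases k with k | k <;> rfl
  · rintro ⟨z, ⟨h₁, h₂⟩, rfl⟩
    exact ⟨h₁, _, h₂⟩

/-- A quantifier over `P(I)/𝓘` becomes a quantifier over tuples of codes: surjectivity of the coding
supplies a code for every witness, and projecting away these coordinates preserves definability. -/
theorem exists_boolean [Finite α] [Finite β] [Finite γ]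
    {R : (α → ReducedProduct 𝓘 M) → (β → PowersetQuotient 𝓘) →
      (γ → PowersetQuotient 𝓘) → Prop}
    (h : c.InterpretsOn L A fun a (X : β ⊕ γ → PowersetQuotient 𝓘) =>
      R a (fun k => X (Sum.inl k)) (fun k => X (Sum.inr k))) :
    c.InterpretsOn L A fun a X => ∃ Y, R a X Y := by
  have h' := Set.Definable.image_comp h
    (Sum.map id (Prod.map Sum.inl id) : α ⊕ β × Fin c.dim → α ⊕ (β ⊕ γ) × Fin c.dim)
  unfold InterpretsOn
  convert h' using 1
  ext z
  constructor
  · rintro ⟨h₁, Y, h₂⟩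
    choose d hd using fun j => c.surjective_proj (Y j)
    obtain rfl : (fun j => c.proj (d j)) = Y := funext hd
    refine ⟨Sum.elim (fun k => z (Sum.inl k)) fun p =>
      Sum.elim (fun j => z (Sum.inr (j, p.2))) (fun j => (d j).1 p.2) p.1, ⟨?_, h₂⟩, ?_⟩
    · rintro (j | j)
      · exact h₁ j
      · exact (d j).2
    · funext k
      rcases k with k | k <;> rfl
  · rintro ⟨z, ⟨h₁, h₂⟩, rfl⟩
    exact ⟨fun j => h₁ (Sum.inl j), _, h₂⟩

theorem forall_main (hc : A.Definable L c.dom) [Finite α] [Finite β] [Finite γ]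
    {R : (α → ReducedProduct 𝓘 M) → (γ → ReducedProduct 𝓘 M) →
      (β → PowersetQuotient 𝓘) → Prop}
    (h : c.InterpretsOn L A fun (a : α ⊕ γ → ReducedProduct 𝓘 M) X =>
      R (fun k => a (Sum.inl k)) (fun k => a (Sum.inr k)) X) :
    c.InterpretsOn L A fun a X => ∀ b, R a b X :=
  ((exists_main (R := fun a b X => ¬ R a b X) (h.not hc)).not hc).congr fun a X => by
    push Not
    rfl

theorem forall_boolean (hc : A.Definable L c.dom) [Finite α] [Finite β] [Finite γ]
    {R : (α → ReducedProduct 𝓘 M) → (β → PowersetQuotient 𝓘) →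
      (γ → PowersetQuotient 𝓘) → Prop}
    (h : c.InterpretsOn L A fun a (X : β ⊕ γ → PowersetQuotient 𝓘) =>
      R a (fun k => X (Sum.inl k)) (fun k => X (Sum.inr k))) :
    c.InterpretsOn L A fun a X => ∀ Y, R a X Y :=
  ((exists_boolean (R := fun a X Y => ¬ R a X Y) (h.not hc)).not hc).congr fun a X => by
    push Not
    rfl

end InterpretsOn

/-! ### Interpreted functions -/

/-- A function to `P(I)/𝓘` is interpreted when its graph is. -/
def InterpretsFunctionOn (c : Coding 𝓘 M) (L : FirstOrder.Language.{u, v})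
    [∀ i, L.Structure (M i)] (A : Set (ReducedProduct 𝓘 M))
    (f : (α → ReducedProduct 𝓘 M) → PowersetQuotient 𝓘) : Prop :=
  c.InterpretsOn L A fun a (X : Fin 1 → PowersetQuotient 𝓘) => f a = X 0

namespace InterpretsFunctionOn

variable {f g : (α → ReducedProduct 𝓘 M) → PowersetQuotient 𝓘}

theorem graph (hc : A.Definable L c.dom) [Finite β] (hf : c.InterpretsFunctionOn L A f)
    (k : α → α') (j : β) :
    c.InterpretsOn L A fun (a : α' → ReducedProduct 𝓘 M) (X : β → PowersetQuotient 𝓘) =>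
      f (fun l => a (k l)) = X j :=
  InterpretsOn.reindex hc hf k fun _ => j

theorem reindex (hc : A.Definable L c.dom) (hf : c.InterpretsFunctionOn L A f) (k : α → α') :
    c.InterpretsFunctionOn L A fun a => f fun l => a (k l) :=
  hf.graph hc k 0

/-- Interpreted functions compose because an intermediate value can be named by an existentially
quantified Boolean variable. The same device serves for `sup` and `le`. -/
theorem compl (hc : c.IsInterpretation L A) [Finite α] (hf : c.InterpretsFunctionOn L A f) :
    c.InterpretsFunctionOn L A fun a => (f a)ᶜ := by
  have h : c.InterpretsOn L A fun a (X : Fin 1 → PowersetQuotient 𝓘) =>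
      ∃ Y : Fin 1 → PowersetQuotient 𝓘, f a = Y 0 ∧ (Y 0)ᶜ = X 0 :=
    InterpretsOn.exists_boolean ((hf.graph hc.dom id (Sum.inr 0)).and
      ((interpretsOn_of_interprets hc.compl).reindex hc.dom Fin.elim0
        ![Sum.inr 0, Sum.inl 0]))
  exact h.congr fun a X => ⟨fun h => ⟨fun _ => f a, rfl, h⟩, fun ⟨Y, h₁, h₂⟩ => by
    beta_reduce
    rw [h₁, h₂]⟩

theorem sup (hc : c.IsInterpretation L A) [Finite α] (hf : c.InterpretsFunctionOn L A f)
    (hg : c.InterpretsFunctionOn L A g) : c.InterpretsFunctionOn L A fun a => f a ⊔ g a := by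
  have h : c.InterpretsOn L A fun a (X : Fin 1 → PowersetQuotient 𝓘) =>
      ∃ Y : Fin 2 → PowersetQuotient 𝓘, f a = Y 0 ∧ g a = Y 1 ∧ Y 0 ⊔ Y 1 = X 0 :=
    InterpretsOn.exists_boolean ((hf.graph hc.dom id (Sum.inr 0)).and
      ((hg.graph hc.dom id (Sum.inr 1)).and
      ((interpretsOn_of_interprets hc.sup).reindex hc.dom Fin.elim0
        ![Sum.inr 0, Sum.inr 1, Sum.inl 0])))
  exact h.congr fun a X => ⟨fun h => ⟨![f a, g a], rfl, rfl, h⟩,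
    fun ⟨Y, h₁, h₂, h₃⟩ => by
    beta_reduce
    rw [h₁, h₂, h₃]⟩

/-- The relation `X ≤ f(a)`. -/
theorem le (hc : c.IsInterpretation L A) [Finite α] [Finite α'] [Finite β]
    (hf : c.InterpretsFunctionOn L A f) (k : α → α') (j : β) :
    c.InterpretsOn L A fun (a : α' → ReducedProduct 𝓘 M) (X : β → PowersetQuotient 𝓘) =>
      X j ⊓ f (fun l => a (k l)) = X j := by
  have h : c.InterpretsOn L A fun (a : α' → ReducedProduct 𝓘 M) (X : β → PowersetQuotient 𝓘) =>
      ∃ Y : Fin 1 → PowersetQuotient 𝓘, f (fun l => a (k l)) = Y 0 ∧ X j ⊓ Y 0 = X j :=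
    InterpretsOn.exists_boolean ((hf.graph hc.dom k (Sum.inr 0)).and
      ((interpretsOn_of_interprets hc.inf).reindex hc.dom Fin.elim0
        ![Sum.inl j, Sum.inr 0, Sum.inl j]))
  exact h.congr fun a X => ⟨fun h => ⟨fun _ => f _, rfl, h⟩,
    fun ⟨Y, h₁, h₂⟩ => by rw [h₁, h₂]⟩

/-- Values of terms are named by quantified main variables; the equations naming them are definable
without parameters. -/
theorem subst (hc : A.Definable L c.dom) [Finite α] [Finite α']
    (hf : c.InterpretsFunctionOn L A f) (t : α → L.Term α') :
    c.InterpretsFunctionOn L A fun (a : α' → ReducedProduct 𝓘 M) =>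
      f fun k => (t k).realize a := by
  have hdef : ∀ k, A.Definable L {a : α' ⊕ α → ReducedProduct 𝓘 M |
      ((t k).relabel Sum.inl).realize a = a (Sum.inr k)} := fun k =>
    (Set.empty_definable_iff.2
      ⟨((t k).relabel Sum.inl).equal (Term.var (Sum.inr k)), by
        ext a
        simp [Formula.realize_equal]⟩).mono (Set.empty_subset _)
  have h : c.InterpretsOn L A fun (a : α' → ReducedProduct 𝓘 M)
      (X : Fin 1 → PowersetQuotient 𝓘) =>
      ∃ b : α → ReducedProduct 𝓘 M, (∀ k, (t k).realize a = b k) ∧ f b = X 0 := by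
    refine InterpretsOn.exists_main (InterpretsOn.and (InterpretsOn.forall_of_finite hc fun k =>
      (InterpretsOn.of_definable hc (hdef k)).congr fun a X => ?_) (hf.graph hc Sum.inr 0))
    simp [Term.realize_relabel, Function.comp_def]
  exact h.congr fun a X => ⟨fun h => ⟨_, fun _ => rfl, h⟩, fun ⟨b, h₁, h₂⟩ => by
    rw [← h₂]
    exact congrArg f (funext h₁)⟩

end InterpretsFunctionOn

end Coding

/-! ### Interpretability of support functions -/

section Support

variable {I : Type w} {𝓘 : Order.Ideal (Set I)} {M : I → Type x}

/-- The class of the set of coordinates where a family of relations holds. -/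
noncomputable def supportOn {α : Type*} (S : ∀ i, (α → M i) → Prop)
    (a : α → ReducedProduct 𝓘 M) : PowersetQuotient 𝓘 :=
  PowersetQuotient.mk 𝓘 {i | S i fun k => (a k).rep i}

theorem supportOn_imp {α : Type*} (S T : ∀ i, (α → M i) → Prop)
    (a : α → ReducedProduct 𝓘 M) :
    supportOn (fun i v => S i v → T i v) a = (supportOn S a)ᶜ ⊔ supportOn T a := by
  unfold supportOn
  rw [PowersetQuotient.mk_compl, PowersetQuotient.mk_sup]
  congr 1
  ext i
  simp only [Set.mem_union, Set.mem_compl_iff, Set.mem_ofPred_eq]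
  tauto

theorem inf_suppEq_eq_left {B : Set I} {a b : ReducedProduct 𝓘 M} :
    PowersetQuotient.mk 𝓘 B ⊓ suppEq a b = PowersetQuotient.mk 𝓘 B ↔
      ∀ᶠ i in cofilter 𝓘, i ∈ B → a.rep i = b.rep i :=
  PowersetQuotient.mk_inf_eq_left

/-- Take a set `B` representing `X`. If `a` satisfies `S` at almost all points of `B`, then the
tuple equal to `a` on `B` and to `e` off `B` satisfies `S` almost everywhere; `e` is needed only to
fill the coordinates off `B`. Conversely, a tuple agreeing with `a` on `B` transfers `S` to `a`
there. -/
theorem exists_agree_iff {α : Type*} [Finite α] {S : ∀ i, (α → M i) → Prop}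
    {e : α → ReducedProduct 𝓘 M} (he : ∀ᶠ i in cofilter 𝓘, S i fun k => (e k).rep i)
    (a : α → ReducedProduct 𝓘 M) (X : PowersetQuotient 𝓘) :
    (∃ b : α → ReducedProduct 𝓘 M, (∀ᶠ i in cofilter 𝓘, S i fun k => (b k).rep i) ∧
      ∀ k, X ⊓ suppEq (a k) (b k) = X) ↔ X ⊓ supportOn S a = X := by
  classical
  obtain ⟨B, rfl⟩ := PowersetQuotient.mk_surjective X
  simp only [inf_suppEq_eq_left]
  unfold supportOn
  rw [PowersetQuotient.mk_inf_eq_left]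
  constructor
  · rintro ⟨b, hb, h⟩
    filter_upwards [hb, eventually_all.2 h] with i h₁ h₂ hi
    have : (fun k => (a k).rep i) = fun k => (b k).rep i := funext fun k => h₂ k hi
    simpa only [Set.mem_ofPred_eq, this] using h₁
  · intro h
    refine ⟨fun k => ReducedProduct.mk 𝓘 fun i => if i ∈ B then (a k).rep i else (e k).rep i,
      ?_, fun k => ?_⟩
    · filter_upwards [h, he, eventually_all.2 fun k => ReducedProduct.rep_mk (𝓘 := 𝓘)
        fun i => if i ∈ B then (a k).rep i else (e k).rep i] with i h₁ h₂ h₃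
      simp only [h₃]
      by_cases hi : i ∈ B
      · simpa only [if_pos hi] using h₁ hi
      · simpa only [if_neg hi] using h₂
    · filter_upwards [ReducedProduct.rep_mk (𝓘 := 𝓘)
        fun i => if i ∈ B then (a k).rep i else (e k).rep i] with i h₁ hi
      rw [h₁, if_pos hi]

/-- Antisymmetry of the order, with `Z ≤ X` written `Z ⊓ X = Z`. It identifies a support `X` as the
largest element below it, so that the relation `Z ≤ X` determines the graph. -/
theorem PowersetQuotient.eq_iff_forall_inf {X Y : PowersetQuotient 𝓘} :
    X = Y ↔ Y ⊓ X = Y ∧ ∀ Z, Z ⊓ X = Z → Z ⊓ Y = Z := by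
  obtain ⟨B, rfl⟩ := PowersetQuotient.mk_surjective X
  obtain ⟨C, rfl⟩ := PowersetQuotient.mk_surjective Y
  constructor
  · intro h
    rw [h]
    exact ⟨by rw [mk_inf, Set.inter_self], fun _ h => h⟩
  · rintro ⟨h₁, h₂⟩
    have h₂ := h₂ (mk 𝓘 B) (by rw [mk_inf, Set.inter_self])
    rw [mk_inf_eq_left] at h₁ h₂
    rw [mk_eq_mk_iff]
    filter_upwards [h₁, h₂] with i h₁ h₂
    exact ⟨h₂, h₁⟩

variable {L : FirstOrder.Language.{u, v}} [∀ i, L.Structure (M i)]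
  {A : Set (ReducedProduct 𝓘 M)} {c : Coding 𝓘 M} {α : Type*}

namespace Coding

open InterpretsOn

/-- The support function of a relation which defines a nonempty definable subset of the reduced
product is interpreted. -/
theorem interprets_supportOn (hc : c.IsInterpretation L A)
    (hsupp : c.InterpretsFunction L A (p := 2) fun a => suppEq (a 0) (a 1)) [Finite α]
    {S : ∀ i, (α → M i) → Prop}
    (hS : A.Definable L {b : α → ReducedProduct 𝓘 M |
      ∀ᶠ i in cofilter 𝓘, S i fun k => (b k).rep i})
    (hne : ∃ e : α → ReducedProduct 𝓘 M, ∀ᶠ i in cofilter 𝓘, S i fun k => (e k).rep i) :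
    c.InterpretsFunctionOn L A (supportOn (𝓘 := 𝓘) S) := by
  obtain ⟨e, he⟩ := hne
  have hE : c.InterpretsFunctionOn L A fun a : Fin 2 → ReducedProduct 𝓘 M =>
    suppEq (a 0) (a 1) := hsupp
  have hle : c.InterpretsOn L A fun a (X : Fin 1 → PowersetQuotient 𝓘) =>
      X 0 ⊓ supportOn S a = X 0 := by
    -- The tuple `b` of `exists_agree_iff` is quantified in the main sort: it ranges over a
    -- definable set, and agreement with `a` on `X` is expressed by `supp_=`.
    refine InterpretsOn.congr (exists_main ?_) fun a X => (exists_agree_iff he a (X 0)).symm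
    refine InterpretsOn.and ((of_definable hc.dom hS).reindex hc.dom Sum.inr id) ?_
    exact forall_of_finite hc.dom fun k => hE.le hc ![Sum.inl k, Sum.inr k] 0
  refine InterpretsOn.congr ?_ fun a X => PowersetQuotient.eq_iff_forall_inf
  refine hle.and (InterpretsOn.congr (forall_boolean (γ := Fin 1)
    (R := fun a X Z => Z 0 ⊓ supportOn S a = Z 0 → Z 0 ⊓ X 0 = Z 0) hc.dom ?_)
    fun a X => ⟨fun h Z => h (Z 0), fun h Z => h fun _ => Z⟩)
  exact (hle.reindex hc.dom id fun _ => Sum.inr 0).imp hc.dom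
    ((interpretsOn_of_interprets hc.inf).reindex hc.dom Fin.elim0
      ![Sum.inr 0, Sum.inl 0, Sum.inr 0])

/-- The tuples satisfying an `h`-formula in almost all coordinates are those satisfying it in the
reduced product. They form a set definable without parameters, and satisfiability provides the tuple
used for gluing. -/
theorem interprets_supp_of_isHFormula [∀ i, Nonempty (M i)] (hc : c.IsInterpretation L A)
    (hsupp : c.InterpretsFunction L A (p := 2) fun a => suppEq (a 0) (a 1)) {n : ℕ}
    {φ : L.Formula (Fin n)} (hφ : IsHFormula φ)
    (hsat : ∃ a : Fin n → ReducedProduct 𝓘 M, φ.Realize a) :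
    c.InterpretsFunctionOn L A (supp (𝓘 := 𝓘) (M := M) φ) := by
  refine interprets_supportOn hc hsupp (S := fun _ => φ.Realize) ?_ ?_
  · simp only [← hφ.formula_realize_iff]
    exact (Set.empty_definable_iff.2 ⟨φ, rfl⟩).mono (Set.empty_subset _)
  · simpa only [← hφ.formula_realize_iff] using hsat

/-- No gluing is involved here: the support is the interpreted constant `0`. -/
theorem interprets_supportOn_false (hc : c.IsInterpretation L A) :
    c.InterpretsFunctionOn L A (supportOn (𝓘 := 𝓘) fun i (_ : α → M i) => False) :=
  InterpretsOn.congr ((interpretsOn_of_interprets hc.bot).reindex hc.dom Fin.elim0 ![0])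
    fun a X => by
      show PowersetQuotient.mk 𝓘 {i | False} = X 0 ↔ X 0 = ⊥
      rw [eq_comm, PowersetQuotient.bot_def]
      rfl

theorem interprets_supportOn_imp (hc : c.IsInterpretation L A) [Finite α]
    {S T : ∀ i, (α → M i) → Prop} (hS : c.InterpretsFunctionOn L A (supportOn (𝓘 := 𝓘) S))
    (hT : c.InterpretsFunctionOn L A (supportOn (𝓘 := 𝓘) T)) :
    c.InterpretsFunctionOn L A (supportOn (𝓘 := 𝓘) fun i v => S i v → T i v) :=
  InterpretsOn.congr ((hS.compl hc).sup hc hT) fun a X =>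
    iff_of_eq (congrArg (· = X 0) (supportOn_imp S T a))

/-- If every relation symbol has a nonempty interpretation in the reduced product, then all support
functions are interpreted. -/
theorem interprets_boundedFormula_of_relations [∀ i, Nonempty (M i)]
    (hc : c.IsInterpretation L A)
    (hsupp : c.InterpretsFunction L A (p := 2) fun a => suppEq (a 0) (a 1))
    (hrel : ∀ n, ∀ R : L.Relations n, ∃ a : Fin n → ReducedProduct 𝓘 M, Structure.RelMap R a)
    [Finite α] {n : ℕ} (φ : L.BoundedFormula α n) :
    c.InterpretsFunctionOn L A (supportOn (𝓘 := 𝓘) fun i (v : α ⊕ Fin n → M i) =>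
      φ.Realize (fun k => v (Sum.inl k)) fun k => v (Sum.inr k)) := by
  have helim : ∀ {n : ℕ} {i : I} (v : α ⊕ Fin n → M i),
      Sum.elim (fun k => v (Sum.inl k)) (fun k => v (Sum.inr k)) = v := fun v =>
    Sum.elim_comp_inl_inr v
  induction φ with
  | falsum => exact interprets_supportOn_false hc
  | @equal n s t =>
    -- The support of the equation of two variables is `supp_=` itself; the terms are substituted
    -- afterwards.
    have h : c.InterpretsFunctionOn L A fun a : Fin 2 → ReducedProduct 𝓘 M =>
      supportOn (fun i (v : Fin 2 → M i) => v 0 = v 1) a := hsupp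
    refine InterpretsOn.congr (h.subst hc.dom ![s, t]) fun a X => ?_
    refine iff_of_eq (congrArg (· = X 0) (PowersetQuotient.mk_eq_mk_iff.2 ?_))
    filter_upwards [rep_realize s a, rep_realize t a] with i hs ht
    show (BoundedFormula.equal s t).Realize _ _ ↔
      (s.realize a).rep i = (t.realize a).rep i
    rw [hs, ht]
    show Term.realize (Sum.elim _ _) s = Term.realize (Sum.elim _ _) t ↔ _
    rw [helim fun k => (a k).rep i]
  | @rel n l R ts =>
    -- `R` is first treated with distinct variables as arguments. The terms are substituted only
    -- afterwards, so the instance `R ts` need not be satisfiable.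
    have h : c.InterpretsFunctionOn L A (supportOn (𝓘 := 𝓘) fun i (v : Fin l → M i) =>
        Structure.RelMap R v) := by
      refine interprets_supportOn hc hsupp ?_ ?_
      · simp only [← relMap_iff]
        refine (Set.empty_definable_iff.2
          ⟨R.formula fun k => Term.var k, ?_⟩).mono (Set.empty_subset _)
        ext a
        simp [Formula.realize_rel]
      · simpa only [← relMap_iff] using hrel l R
    refine InterpretsOn.congr (h.subst hc.dom ts) fun a X => ?_
    refine iff_of_eq (congrArg (· = X 0) (PowersetQuotient.mk_eq_mk_iff.2 ?_))
    filter_upwards [rep_realize_all ts a] with i hts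
    show (BoundedFormula.rel R ts).Realize _ _ ↔
      Structure.RelMap R fun k => ((ts k).realize a).rep i
    rw [hts]
    show Structure.RelMap R (fun k => Term.realize (Sum.elim _ _) (ts k)) ↔ _
    rw [helim fun k => (a k).rep i]
  | imp φ ψ ih₁ ih₂ => exact interprets_supportOn_imp hc ih₁ ih₂
  | @all n φ ih =>
    -- The last bound variable is moved to a block of its own, so that it can be quantified in the
    -- reduced product.
    let f : α ⊕ Fin (n + 1) → (α ⊕ Fin n) ⊕ Fin 1 := Sum.elim (fun k => Sum.inl (Sum.inl k))
      (Fin.snoc (α := fun _ => (α ⊕ Fin n) ⊕ Fin 1) (fun k => Sum.inl (Sum.inr k)) (Sum.inr 0))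
    have h := ih.reindex hc.dom f
    have hall : ∀ {i : I} (v : α ⊕ Fin n → M i),
        φ.all.Realize (fun k => v (Sum.inl k)) (fun k => v (Sum.inr k)) ↔
        ∀ y, φ.Realize (fun k => Sum.elim v (fun _ => y) (f (Sum.inl k)))
          fun k => Sum.elim v (fun _ => y) (f (Sum.inr k)) := by
      intro i v
      rw [BoundedFormula.realize_all]
      refine forall_congr' fun y => ?_
      have h₂ : Fin.snoc (α := fun _ => M i) (fun k => v (Sum.inr k)) y =
          fun k => Sum.elim v (fun _ => y) (f (Sum.inr k)) := by
        funext k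
        refine Fin.lastCases ?_ (fun k => ?_) k <;> simp [f]
      rw [h₂]
      rfl
    have hrep : ∀ (a : α ⊕ Fin n → ReducedProduct 𝓘 M) (b : Fin 1 → ReducedProduct 𝓘 M) (i : I) k,
        (Sum.elim a b k).rep i = Sum.elim (fun k => (a k).rep i) (fun _ => (b 0).rep i) k := by
      rintro a b i (k | k)
      · rfl
      · rw [Subsingleton.elim k 0]
        rfl
    let S : ∀ i, (α ⊕ Fin (n + 1) → M i) → Prop := fun i v =>
      φ.Realize (fun k => v (Sum.inl k)) fun k => v (Sum.inr k)
    -- `X` is the minimum of the supports of `φ` at `(a, b)` over all `b`: it is attained, and it is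
    -- a lower bound.
    have hdef : c.InterpretsOn L A fun (a : α ⊕ Fin n → ReducedProduct 𝓘 M)
        (X : Fin 1 → PowersetQuotient 𝓘) =>
        (∃ b : Fin 1 → ReducedProduct 𝓘 M, supportOn S (fun k => Sum.elim a b (f k)) = X 0) ∧
        ∀ b : Fin 1 → ReducedProduct 𝓘 M,
          X 0 ⊓ supportOn S (fun k => Sum.elim a b (f k)) = X 0 := by
      refine InterpretsOn.and (exists_main (InterpretsOn.congr h fun a X => ?_))
        (forall_main hc.dom (InterpretsOn.congr (ih.le hc f 0) fun a X => ?_))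
      · rw [← Sum.elim_comp_inl_inr a]; rfl
      · rw [← Sum.elim_comp_inl_inr a]; rfl
    refine hdef.congr fun a X => ?_
    -- With `b` a counterexample wherever one exists, `φ` at `(a, b)` already forces `∀ y φ`. Hence
    -- the minimum is attained and equals the support of `∀ y φ`.
    have hmin : ∃ b : Fin 1 → ReducedProduct 𝓘 M, ∀ᶠ i in cofilter 𝓘,
        (S i fun k => (Sum.elim a b (f k)).rep i) →
          φ.all.Realize (fun k => (a (Sum.inl k)).rep i) fun k => (a (Sum.inr k)).rep i := by
      obtain ⟨b, hb⟩ := ReducedProduct.exists_forall_of_eventually (𝓘 := 𝓘) (p := fun i y =>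
        ¬ S i fun k => Sum.elim (fun k => (a k).rep i) (fun _ => y) (f k))
      refine ⟨fun _ => b, hb.mono fun i hi hSi => (hall fun k => (a k).rep i).2 fun y => ?_⟩
      by_contra hcon
      simp only [hrep] at hSi
      exact hi ⟨y, hcon⟩ hSi
    have hle : ∀ (b : Fin 1 → ReducedProduct 𝓘 M) (i : I),
        (φ.all.Realize (fun k => (a (Sum.inl k)).rep i) fun k => (a (Sum.inr k)).rep i) →
        S i fun k => (Sum.elim a b (f k)).rep i := by
      intro b i hi
      simp only [hrep]
      exact (hall fun k => (a k).rep i).1 hi _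
    constructor
    · intro hX
      rw [← hX]
      obtain ⟨b, hb⟩ := hmin
      refine ⟨⟨b, PowersetQuotient.mk_eq_mk_iff.2 (hb.mono fun i hi => ⟨hi, hle b i⟩)⟩,
        fun b => PowersetQuotient.mk_inf_eq_left.2 (Eventually.of_forall (hle b))⟩
    · rintro ⟨⟨b, hb⟩, hX⟩
      obtain ⟨b', hb'⟩ := hmin
      -- The lower bound `X` lies below the value at the minimizing `b'`, which is the support of `∀
      -- y φ`; as a value at `b`, it also lies above that support.
      have h₁ := hX b'
      rw [← hb] at h₁ ⊢
      have h₁ := PowersetQuotient.mk_inf_eq_left.1 h₁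
      refine PowersetQuotient.mk_eq_mk_iff.2 ?_
      filter_upwards [h₁, hb'] with i h₂ h₃
      exact ⟨hle b i, fun h => h₃ (h₂ h)⟩

theorem interprets_supp_of_relations [∀ i, Nonempty (M i)] (hc : c.IsInterpretation L A)
    (hsupp : c.InterpretsFunction L A (p := 2) fun a => suppEq (a 0) (a 1))
    (hrel : ∀ n, ∀ R : L.Relations n, ∃ a : Fin n → ReducedProduct 𝓘 M, Structure.RelMap R a)
    {n : ℕ} (φ : L.Formula (Fin n)) :
    c.InterpretsFunctionOn L A (supp (𝓘 := 𝓘) (M := M) φ) := by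
  refine InterpretsOn.congr ((interprets_boundedFormula_of_relations hc hsupp hrel φ).reindex
    hc.dom (Sum.elim id Fin.elim0)) fun a X => iff_of_eq (congrArg (· = X 0) ?_)
  refine PowersetQuotient.mk_eq_mk_iff.2 (Eventually.of_forall fun i => iff_of_eq ?_)
  exact congrArg (BoundedFormula.Realize φ _) (Subsingleton.elim _ _)

theorem interprets_supp_of_isBooleanCombination (hc : c.IsInterpretation L A)
    {Φ : ∀ n, Set (L.Formula (Fin n))}
    (hΦ : ∀ n, ∀ φ ∈ Φ n, c.InterpretsFunctionOn L A (supp (𝓘 := 𝓘) (M := M) φ)) {n : ℕ}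
    {β : L.Formula (Fin n)} (hβ : IsBooleanCombination Φ β) :
    c.InterpretsFunctionOn L A (supp (𝓘 := 𝓘) (M := M) β) := by
  induction hβ with
  | @mem k φ hφ σ =>
    refine InterpretsOn.congr ((hΦ k φ hφ).reindex hc.dom σ) fun a X => ?_
    unfold supp
    simp only [Formula.realize_relabel, Function.comp_def]
  | falsum => exact interprets_supportOn_false hc
  | imp _ _ ih₁ ih₂ => exact interprets_supportOn_imp hc ih₁ ih₂

end Coding

theorem eventually_of_equivModulo {n : ℕ} {φ ψ : L.Formula (Fin n)} (h : EquivModulo 𝓘 M φ ψ) :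
    ∀ᶠ i in cofilter 𝓘, ∀ a : Fin n → M i, φ.Realize a ↔ ψ.Realize a :=
  (equivModulo_iff 𝓘 M φ ψ).1 h

theorem supp_eq_of_equivModulo {n : ℕ} {φ ψ : L.Formula (Fin n)} (h : EquivModulo 𝓘 M φ ψ) :
    supp (𝓘 := 𝓘) (M := M) φ = supp ψ :=
  funext fun _ => PowersetQuotient.mk_eq_mk_iff.2
    ((eventually_of_equivModulo h).mono fun _ hi => hi _)

end Support

/-! ### The language of Boolean algebras -/

/-- The function symbols of the language of Boolean algebras. -/
inductive BoolFunctions : ℕ → Type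
  | bot : BoolFunctions 0
  | top : BoolFunctions 0
  | compl : BoolFunctions 1
  | inf : BoolFunctions 2
  | sup : BoolFunctions 2

/-- The language of Boolean algebras. -/
def boolLanguage : FirstOrder.Language.{0, 0} := ⟨BoolFunctions, fun _ => Empty⟩

instance {I : Type w} {𝓘 : Order.Ideal (Set I)} : boolLanguage.Structure (PowersetQuotient 𝓘) where
  funMap
    | .bot, _ => ⊥
    | .top, _ => ⊤
    | .compl, X => (X 0)ᶜ
    | .inf, X => X 0 ⊓ X 1
    | .sup, X => X 0 ⊔ X 1
  RelMap R := R.elim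

namespace boolLanguage

variable {I : Type w} {𝓘 : Order.Ideal (Set I)} {α : Type*}

/-- The term `sᶜ`. -/
def compl (s : boolLanguage.Term α) : boolLanguage.Term α :=
  Term.func (L := boolLanguage) (l := 1) BoolFunctions.compl ![s]

/-- The term `s ∩ t`. -/
def inf (s t : boolLanguage.Term α) : boolLanguage.Term α :=
  Term.func (L := boolLanguage) (l := 2) BoolFunctions.inf ![s, t]

/-- The term `s ∪ t`. -/
def sup (s t : boolLanguage.Term α) : boolLanguage.Term α :=
  Term.func (L := boolLanguage) (l := 2) BoolFunctions.sup ![s, t]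

/-- The term `0`. -/
def bot : boolLanguage.Term α := Term.func (L := boolLanguage) (l := 0) BoolFunctions.bot ![]

/-- The term `1`. -/
def top : boolLanguage.Term α := Term.func (L := boolLanguage) (l := 0) BoolFunctions.top ![]

variable (X : α → PowersetQuotient 𝓘)

theorem realize_compl (s : boolLanguage.Term α) : (compl s).realize X = (s.realize X)ᶜ := rfl

theorem realize_inf (s t : boolLanguage.Term α) :
    (inf s t).realize X = s.realize X ⊓ t.realize X := rfl

theorem realize_sup (s t : boolLanguage.Term α) :
    (sup s t).realize X = s.realize X ⊔ t.realize X := rfl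

theorem realize_top : (top : boolLanguage.Term α).realize X = ⊤ := rfl

/-- Atoms of the Boolean algebra generated by finitely many elements are given by terms. -/
theorem exists_term_atom [Finite α] (S : Set α) :
    ∃ t : boolLanguage.Term α, ∀ B : α → Set I,
      t.realize (fun j => PowersetQuotient.mk 𝓘 (B j)) =
        PowersetQuotient.mk 𝓘 {i | ∀ j, i ∈ B j ↔ j ∈ S} := by
  have key : ∀ l : List α, ∃ t : boolLanguage.Term α, ∀ B : α → Set I,
      t.realize (fun j => PowersetQuotient.mk 𝓘 (B j)) =
        PowersetQuotient.mk 𝓘 {i | ∀ j ∈ l, (i ∈ B j ↔ j ∈ S)} := by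
    intro l
    induction l with
    | nil =>
      refine ⟨top, fun B => ?_⟩
      rw [realize_top, PowersetQuotient.top_def]
      simp
    | cons j l ih =>
      obtain ⟨t, ht⟩ := ih
      by_cases hj : j ∈ S
      · refine ⟨inf (Term.var j) t, fun B => ?_⟩
        rw [realize_inf, ht, Term.realize_var, PowersetQuotient.mk_inf]
        congr 1
        ext i
        simp [hj]
      · refine ⟨inf (compl (Term.var j)) t, fun B => ?_⟩
        rw [realize_inf, ht, realize_compl, Term.realize_var, PowersetQuotient.mk_compl,
          PowersetQuotient.mk_inf]
        congr 1
        ext i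
        simp [hj]
  cases nonempty_fintype α
  simpa using key Finset.univ.toList

end boolLanguage

/-! ### Elimination of quantifiers relative to the Boolean sort -/

section FefermanVaught

/-- A formula uses only finitely many of its variables. -/
theorem exists_finite_restrict {L : FirstOrder.Language.{u, v}} {α : Type w} {β : Type x}
    (ψ : L.Formula (α ⊕ β)) : ∃ (ι : Type w) (_ : Finite ι) (f : ι → α) (ψ' : L.Formula (ι ⊕ β)),
      ∀ (N : Type _) [L.Structure N] (v : α → N) (z : β → N),
        ψ'.Realize (Sum.elim (fun j => v (f j)) z) ↔ ψ.Realize (Sum.elim v z) := by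
  classical
  let s : Set α := Sum.inl ⁻¹' (ψ.freeVarFinset : Set (α ⊕ β))
  have hs : Finite s := (Set.Finite.preimage Sum.inl_injective.injOn
    (Finset.finite_toSet _)).to_subtype
  let g : ψ.freeVarFinset → s ⊕ β := fun p => match p with
    | ⟨Sum.inl a, h⟩ => Sum.inl ⟨a, h⟩
    | ⟨Sum.inr b, _⟩ => Sum.inr b
  refine ⟨s, hs, Subtype.val, ψ.restrictFreeVar g, fun N _ v z => ?_⟩
  refine BoundedFormula.realize_restrictFreeVar _ ?_
  rintro ⟨a | b, h⟩ <;> rfl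

/-- Formulas stating that some value of the last variable realizes a prescribed pattern. -/
theorem exists_formula_pattern {L : FirstOrder.Language.{u, v}} {ι : Type*} [Finite ι] {m : ℕ}
    (f : ι → L.Formula (Fin (m + 1))) (S : Set ι) :
    ∃ θ : L.Formula (Fin m), ∀ (N : Type x) [L.Structure N] (a : Fin m → N),
      θ.Realize a ↔ ∃ y : N, ∀ j, ((f j).Realize (Fin.snoc (α := fun _ => N) a y) ↔ j ∈ S) := by
  classical
  let e : Fin (m + 1) → Fin m ⊕ Fin 1 :=
    Fin.snoc (α := fun _ => Fin m ⊕ Fin 1) Sum.inl (Sum.inr 0)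
  refine ⟨Formula.iExs (Fin 1) (Formula.iInf fun j =>
    (if j ∈ S then f j else (f j).not).relabel e), fun N _ a => ?_⟩
  have he : ∀ y : Fin 1 → N, Sum.elim a y ∘ e = Fin.snoc (α := fun _ => N) a (y 0) := by
    intro y
    funext k
    refine Fin.lastCases ?_ (fun k => ?_) k <;> simp [e]
  have hj : ∀ (j : ι) (w : Fin (m + 1) → N),
      (if j ∈ S then f j else (f j).not).Realize w ↔ ((f j).Realize w ↔ j ∈ S) := by
    intro j w
    by_cases h : j ∈ S <;> simp [h, Formula.realize_not]
  simp only [Formula.realize_iExs, Formula.realize_iInf, Formula.realize_relabel, he, hj]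
  exact ⟨fun ⟨y, hy⟩ => ⟨y 0, hy⟩, fun ⟨y, hy⟩ => ⟨fun _ => y, hy⟩⟩

variable {L : FirstOrder.Language.{u, v}} {Φ : ∀ n, Set (L.Formula (Fin n))}
  {I : Type w} {𝓘 : Order.Ideal (Set I)} {M : I → Type x} [∀ i, L.Structure (M i)]

/-- A tuple of elements of `P(I)/𝓘` consists of the supports of given formulas at some element when
its atoms are contained in the supports of the corresponding existential formulas. -/
theorem exists_supp_snoc_eq_iff [∀ i, Nonempty (M i)] {ι : Type*} [Finite ι] {m : ℕ}
    (f : ι → L.Formula (Fin (m + 1))) {θ : Set ι → L.Formula (Fin m)}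
    (hθ : ∀ S (N : Type x) [L.Structure N] (a : Fin m → N), (θ S).Realize a ↔
      ∃ y : N, ∀ j, ((f j).Realize (Fin.snoc (α := fun _ => N) a y) ↔ j ∈ S))
    {t : Set ι → boolLanguage.Term ι}
    (ht : ∀ S (B : ι → Set I), (t S).realize (fun j => PowersetQuotient.mk 𝓘 (B j)) =
      PowersetQuotient.mk 𝓘 {i | ∀ j, i ∈ B j ↔ j ∈ S})
    (a : Fin m → ReducedProduct 𝓘 M) (Y : ι → PowersetQuotient 𝓘) :
    (∀ S, (t S).realize Y ⊓ supp (θ S) a = (t S).realize Y) ↔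
      ∃ b : ReducedProduct 𝓘 M,
        (fun j => supp (f j) (Fin.snoc (α := fun _ => ReducedProduct 𝓘 M) a b)) = Y := by
  choose B hB using fun j => PowersetQuotient.mk_surjective (Y j)
  obtain rfl : (fun j => PowersetQuotient.mk 𝓘 (B j)) = Y := funext hB
  simp only [ht, funext_iff]
  unfold supp
  simp only [PowersetQuotient.mk_inf_eq_left, PowersetQuotient.mk_eq_mk_iff,
    Set.mem_ofPred_eq, hθ, ReducedProduct.rep_snoc]
  -- As `ι` is finite, there are finitely many patterns `S`, so one exceptional set in the ideal
  -- serves for all of them.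
  rw [← eventually_all]
  constructor
  · intro h
    -- At coordinate `i` the pattern to be realized is the set of `j` with `i ∈ B j`. The hypothesis
    -- for this pattern says that some `y` realizes it.
    obtain ⟨b, hb⟩ := ReducedProduct.exists_forall_of_eventually (𝓘 := 𝓘) (p := fun i y =>
      ∀ j, ((f j).Realize (Fin.snoc (α := fun _ => M i) (fun k => (a k).rep i) y) ↔ i ∈ B j))
    refine ⟨b, fun j => ?_⟩
    filter_upwards [h, hb] with i h₁ h₂
    exact h₂ (h₁ {j | i ∈ B j} fun j => Iff.rfl) j
  · rintro ⟨b, hb⟩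
    filter_upwards [eventually_all.2 hb] with i h S hS
    exact ⟨b.rep i, fun j => (h j).trans (hS j)⟩

/-- Terms of the Boolean sort as terms of the language of Boolean algebras in the supports of
`L`-formulas. -/
noncomputable def BoolTerm.toTerm {m k : ℕ} :
    BoolTerm Φ m k → boolLanguage.Term (L.Formula (Fin m) ⊕ Fin k)
  | .var j => Term.var (Sum.inr j)
  | .supp φ _ t => Term.var (Sum.inl (BoundedFormula.subst φ t))
  | .bot => boolLanguage.bot
  | .top => boolLanguage.top
  | .compl s => boolLanguage.compl s.toTerm
  | .inf s t => boolLanguage.inf s.toTerm t.toTerm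
  | .sup s t => boolLanguage.sup s.toTerm t.toTerm

theorem supp_subst {m n : ℕ} (φ : L.Formula (Fin n)) (t : Fin n → L.Term (Fin m))
    (a : Fin m → ReducedProduct 𝓘 M) :
    supp (BoundedFormula.subst φ t : L.Formula (Fin m)) a = supp φ fun l => (t l).realize a := by
  refine PowersetQuotient.mk_eq_mk_iff.2 ?_
  filter_upwards [rep_realize_all t a] with i hi
  simp only [hi]
  exact BoundedFormula.realize_subst

theorem BoolTerm.realize_toTerm {m k : ℕ} (s : BoolTerm Φ m k) (a : Fin m → ReducedProduct 𝓘 M)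
    (X : Fin k → PowersetQuotient 𝓘) :
    s.toTerm.realize (Sum.elim (fun φ => FV.supp φ a) X) = s.realize a X := by
  induction s with
  | var j => rfl
  | supp φ _ t => exact supp_subst φ t a
  | bot => rfl
  | top => rfl
  | compl s ih => rw [toTerm, boolLanguage.realize_compl, ih]; rfl
  | inf s t ih₁ ih₂ => rw [toTerm, boolLanguage.realize_inf, ih₁, ih₂]; rfl
  | sup s t ih₁ ih₂ => rw [toTerm, boolLanguage.realize_sup, ih₁, ih₂]; rfl

theorem supp_eq_top_iff {m : ℕ} (φ : L.Formula (Fin m)) (a : Fin m → ReducedProduct 𝓘 M) :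
    supp φ a = ⊤ ↔ ∀ᶠ i in cofilter 𝓘, φ.Realize fun k => (a k).rep i :=
  PowersetQuotient.mk_eq_top

/-- The Feferman–Vaught theorem: a two-sorted formula expresses a property of the supports of
`L`-formulas which is definable in the Boolean algebra. -/
theorem exists_boolLanguage_formula (𝓘 : Order.Ideal (Set I)) (M : I → Type x)
    [∀ i, L.Structure (M i)] [∀ i, Nonempty (M i)] {m k : ℕ} (χ : TwoSortedFormula Φ m k) :
    ∃ ψ : boolLanguage.Formula (L.Formula (Fin m) ⊕ Fin k),
      ∀ (a : Fin m → ReducedProduct 𝓘 M) (X : Fin k → PowersetQuotient 𝓘),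
        χ.Realize a X ↔ ψ.Realize (Sum.elim (fun φ => supp φ a) X) := by
  induction χ with
  | falsum => exact ⟨⊥, fun a X => Iff.rfl⟩
  | eqMain s t =>
    -- An atomic formula of the main sort holds in the reduced product exactly when its support is
    -- `1`.
    refine ⟨(Term.var (Sum.inl (s.equal t))).equal boolLanguage.top, fun a X => ?_⟩
    rw [Formula.realize_equal, boolLanguage.realize_top, Term.realize_var, Sum.elim_inl,
      supp_eq_top_iff]
    show s.realize a = t.realize a ↔ _
    rw [ReducedProduct.eq_iff]
    refine eventually_congr ?_
    filter_upwards [rep_realize s a, rep_realize t a] with i h₁ h₂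
    rw [h₁, h₂, Formula.realize_equal]
  | rel R t =>
    refine ⟨(Term.var (Sum.inl (R.formula t))).equal boolLanguage.top, fun a X => ?_⟩
    rw [Formula.realize_equal, boolLanguage.realize_top, Term.realize_var, Sum.elim_inl,
      supp_eq_top_iff]
    show Structure.RelMap R (fun l => (t l).realize a) ↔ _
    rw [relMap_iff]
    refine eventually_congr ?_
    filter_upwards [rep_realize_all t a] with i h
    rw [h, Formula.realize_rel]
  | eqBool s t =>
    refine ⟨s.toTerm.equal t.toTerm, fun a X => ?_⟩
    rw [Formula.realize_equal, BoolTerm.realize_toTerm, BoolTerm.realize_toTerm]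
    rfl
  | imp χ₁ χ₂ ih₁ ih₂ =>
    obtain ⟨ψ₁, h₁⟩ := ih₁
    obtain ⟨ψ₂, h₂⟩ := ih₂
    refine ⟨ψ₁.imp ψ₂, fun a X => ?_⟩
    rw [Formula.realize_imp, ← h₁, ← h₂]
    rfl
  | @allMain m k χ ih =>
    obtain ⟨ψ, hψ⟩ := ih
    -- The support variables of `ψ` are indexed by all `L`-formulas in `m + 1` variables. Only
    -- finitely many occur; a finite index type is needed for atoms and patterns to be expressible.
    obtain ⟨ι, _, f, ψ', hψ'⟩ := exists_finite_restrict ψ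
    choose θ hθ using exists_formula_pattern.{u, v, x} f
    choose t ht using boolLanguage.exists_term_atom (𝓘 := 𝓘) (α := ι)
    -- The quantifier over `b` is replaced by one over tuples `Y` of supports. The premise says that
    -- `Y` is realized by some `b`: each atom of `Y` lies below the support of the matching `θ S`.
    refine ⟨Formula.iAlls ι ((Formula.iInf fun S : Set ι =>
      (boolLanguage.inf ((t S).relabel Sum.inr) (Term.var (Sum.inl (Sum.inl (θ S))))).equal
        ((t S).relabel Sum.inr)).imp
      (ψ'.relabel (Sum.elim Sum.inr (Sum.inl ∘ Sum.inr)))), fun a X => ?_⟩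
    have hvar : ∀ Y : ι → PowersetQuotient 𝓘,
        (Sum.elim (Sum.elim (fun φ : L.Formula (Fin m) => supp φ a) X) Y ∘
          Sum.elim Sum.inr (Sum.inl ∘ Sum.inr) :
          ι ⊕ Fin k → PowersetQuotient 𝓘) = Sum.elim Y X := by
      intro Y
      funext j
      rcases j with j | j <;> rfl
    have hinf : ∀ (Y : ι → PowersetQuotient 𝓘) (S : Set ι),
        (boolLanguage.inf ((t S).relabel Sum.inr) (Term.var (Sum.inl (Sum.inl (θ S))))).realize
          (Sum.elim (Sum.elim (fun φ => supp φ a) X) Y) = (t S).realize Y ⊓ supp (θ S) a := by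
      intro Y S
      rw [boolLanguage.realize_inf, Term.realize_relabel, Sum.elim_comp_inr]
      rfl
    simp only [Formula.realize_iAlls, Formula.realize_imp, Formula.realize_iInf,
      Formula.realize_equal, Formula.realize_relabel, hinf, Term.realize_relabel,
      Sum.elim_comp_inr, hvar]
    simp only [exists_supp_snoc_eq_iff f hθ ht a]
    show (∀ b, χ.Realize (Fin.snoc (α := fun _ => ReducedProduct 𝓘 M) a b) X) ↔ _
    simp only [hψ]
    refine ⟨fun h Y ⟨b, hb⟩ => ?_, fun h b => (hψ' _ _ _).1 (h _ ⟨b, rfl⟩)⟩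
    rw [← hb]
    exact (hψ' _ _ _).2 (h b)
  | @allBool m k χ ih =>
    obtain ⟨ψ, hψ⟩ := ih
    let e : L.Formula (Fin m) ⊕ Fin (k + 1) → (L.Formula (Fin m) ⊕ Fin k) ⊕ Fin 1 :=
      Sum.elim (fun φ => Sum.inl (Sum.inl φ))
        (Fin.snoc (α := fun _ => (L.Formula (Fin m) ⊕ Fin k) ⊕ Fin 1)
          (fun j => Sum.inl (Sum.inr j)) (Sum.inr 0))
    refine ⟨Formula.iAlls (Fin 1) (ψ.relabel e), fun a X => ?_⟩
    have he : ∀ Y : Fin 1 → PowersetQuotient 𝓘,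
        Sum.elim (Sum.elim (fun φ : L.Formula (Fin m) => supp φ a) X) Y ∘ e =
        Sum.elim (fun φ => supp φ a) (Fin.snoc (α := fun _ => PowersetQuotient 𝓘) X (Y 0)) := by
      intro Y
      funext j
      rcases j with j | j
      · rfl
      · refine Fin.lastCases ?_ (fun j => ?_) j <;> simp [e]
    simp only [Formula.realize_iAlls, Formula.realize_relabel, he, ← hψ]
    exact ⟨fun h Y => h (Y 0), fun h Y => h fun _ => Y⟩

/-! ### Return from Boolean-algebra formulas to the two-sorted language -/

theorem BoolTerm.exists_weaken (𝓘 : Order.Ideal (Set I)) (M : I → Type x)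
    [∀ i, L.Structure (M i)] {m k : ℕ} (n : ℕ) (s : BoolTerm Φ m k) :
    ∃ s' : BoolTerm Φ m (k + n), ∀ (a : Fin m → ReducedProduct 𝓘 M)
      (X : Fin k → PowersetQuotient 𝓘) (Y : Fin n → PowersetQuotient 𝓘),
      s'.realize a (Fin.append X Y) = s.realize a X := by
  induction s with
  | var j => exact ⟨.var (Fin.castAdd n j), fun a X Y => Fin.append_left X Y j⟩
  | supp φ hφ t => exact ⟨.supp φ hφ t, fun a X Y => rfl⟩
  | bot => exact ⟨.bot, fun a X Y => rfl⟩
  | top => exact ⟨.top, fun a X Y => rfl⟩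
  | compl s ih =>
    obtain ⟨s', hs⟩ := ih
    exact ⟨.compl s', fun a X Y => congrArg _ (hs a X Y)⟩
  | inf s t ih₁ ih₂ =>
    obtain ⟨s', hs⟩ := ih₁
    obtain ⟨t', ht⟩ := ih₂
    exact ⟨.inf s' t', fun a X Y => congrArg₂ _ (hs a X Y) (ht a X Y)⟩
  | sup s t ih₁ ih₂ =>
    obtain ⟨s', hs⟩ := ih₁
    obtain ⟨t', ht⟩ := ih₂
    exact ⟨.sup s' t', fun a X Y => congrArg₂ _ (hs a X Y) (ht a X Y)⟩

/-- Substitution of Boolean terms into a term of the language of Boolean algebras. -/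
theorem exists_boolTerm_subst (𝓘 : Order.Ideal (Set I)) (M : I → Type x)
    [∀ i, L.Structure (M i)] {α : Type*} {m k n : ℕ} (σ : α → BoolTerm Φ m k)
    (t : boolLanguage.Term (α ⊕ Fin n)) :
    ∃ s : BoolTerm Φ m (k + n), ∀ (a : Fin m → ReducedProduct 𝓘 M)
      (X : Fin k → PowersetQuotient 𝓘) (Y : Fin n → PowersetQuotient 𝓘),
      s.realize a (Fin.append X Y) =
        t.realize (Sum.elim (fun j => (σ j).realize a X) Y) := by
  induction t with
  | var j =>
    rcases j with j | j
    · exact (σ j).exists_weaken 𝓘 M n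
    · exact ⟨.var (Fin.natAdd k j), fun a X Y => Fin.append_right X Y j⟩
  | func f ts ih =>
    choose s hs using ih
    cases f with
    | bot => exact ⟨.bot, fun a X Y => rfl⟩
    | top => exact ⟨.top, fun a X Y => rfl⟩
    | compl => exact ⟨.compl (s 0), fun a X Y => congrArg _ (hs 0 a X Y)⟩
    | inf => exact ⟨.inf (s 0) (s 1), fun a X Y => congrArg₂ _ (hs 0 a X Y) (hs 1 a X Y)⟩
    | sup => exact ⟨.sup (s 0) (s 1), fun a X Y => congrArg₂ _ (hs 0 a X Y) (hs 1 a X Y)⟩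

/-- Substitution of Boolean terms into a formula of the language of Boolean algebras. -/
theorem exists_isBoolean_subst (𝓘 : Order.Ideal (Set I)) (M : I → Type x)
    [∀ i, L.Structure (M i)] {α : Type*} {m k n : ℕ} (σ : α → BoolTerm Φ m k)
    (ψ : boolLanguage.BoundedFormula α n) :
    ∃ χ : TwoSortedFormula Φ m (k + n), χ.IsBoolean ∧ ∀ (a : Fin m → ReducedProduct 𝓘 M)
      (X : Fin k → PowersetQuotient 𝓘) (Y : Fin n → PowersetQuotient 𝓘),
      χ.Realize a (Fin.append X Y) ↔ ψ.Realize (fun j => (σ j).realize a X) Y := by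
  induction ψ with
  | falsum => exact ⟨.falsum, .falsum, fun a X Y => Iff.rfl⟩
  | equal s t =>
    obtain ⟨s', hs⟩ := exists_boolTerm_subst 𝓘 M σ s
    obtain ⟨t', ht⟩ := exists_boolTerm_subst 𝓘 M σ t
    refine ⟨.eqBool s' t', .eqBool s' t', fun a X Y => ?_⟩
    show s'.realize a _ = t'.realize a _ ↔ _
    rw [hs, ht]
    rfl
  | rel R => exact R.elim
  | imp _ _ ih₁ ih₂ =>
    obtain ⟨χ₁, hb₁, h₁⟩ := ih₁
    obtain ⟨χ₂, hb₂, h₂⟩ := ih₂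
    exact ⟨.imp χ₁ χ₂, .imp hb₁ hb₂, fun a X Y => imp_congr (h₁ a X Y) (h₂ a X Y)⟩
  | all _ ih =>
    obtain ⟨χ, hb, h⟩ := ih
    refine ⟨.allBool χ, .allBool hb, fun a X Y => forall_congr' fun Z => ?_⟩
    rw [← h, Fin.append_snoc]

/-- Supports of Boolean combinations of formulas from `Φ` are values of Boolean terms. -/
theorem IsBooleanCombination.exists_boolTerm (𝓘 : Order.Ideal (Set I)) (M : I → Type x)
    [∀ i, L.Structure (M i)] {m : ℕ} (k : ℕ) {β : L.Formula (Fin m)}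
    (hβ : IsBooleanCombination Φ β) :
    ∃ s : BoolTerm Φ m k, ∀ (a : Fin m → ReducedProduct 𝓘 M) (X : Fin k → PowersetQuotient 𝓘),
      s.realize a X = supp β a := by
  induction hβ with
  | @mem n φ hφ σ =>
    refine ⟨.supp φ hφ fun l => Term.var (σ l), fun a X => ?_⟩
    show supp φ (fun l => a (σ l)) = _
    unfold supp
    simp only [Formula.realize_relabel, Function.comp_def]
  | falsum => exact ⟨.bot, fun a X => rfl⟩
  | @imp φ ψ _ _ ih₁ ih₂ =>
    obtain ⟨s, hs⟩ := ih₁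
    obtain ⟨t, ht⟩ := ih₂
    refine ⟨.sup (.compl s) t, fun a X => ?_⟩
    show (s.realize a X)ᶜ ⊔ t.realize a X = _
    rw [hs, ht]
    exact (supportOn_imp _ _ a).symm

/-- The Boolean-algebra formula equivalent to `χ` has supports of arbitrary `L`-formulas as
arguments. By fundamentality each is the support of a Boolean combination of formulas from `Φ`,
hence the value of a Boolean term over `Φ`. The outcome is a single formula `ψ(s₁, …, s_r)`, as
equations and relations of the main sort have become equations between supports and `1`. -/
theorem eliminatesQuantifiersRelative_of_isFundamental [∀ i, Nonempty (M i)]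
    (hfund : IsFundamental 𝓘 M Φ) : EliminatesQuantifiersRelative Φ 𝓘 M := by
  intro m k χ
  obtain ⟨ψ, hψ⟩ := exists_boolLanguage_formula 𝓘 M χ
  have hterm : ∀ φ : L.Formula (Fin m), ∃ s : BoolTerm Φ m k,
      ∀ (a : Fin m → ReducedProduct 𝓘 M) (X : Fin k → PowersetQuotient 𝓘),
        s.realize a X = supp φ a := by
    intro φ
    obtain ⟨β, hβ, hφβ⟩ := hfund m φ
    rw [supp_eq_of_equivModulo hφβ]
    exact hβ.exists_boolTerm 𝓘 M k
  choose s hs using hterm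
  obtain ⟨χ', hb, h⟩ := exists_isBoolean_subst 𝓘 M (Sum.elim s BoolTerm.var) ψ
  refine ⟨χ', .boolean hb, fun a X => ?_⟩
  -- `ψ` has no bound variables left open at the top level, so the tuple appended to `X` is empty.
  have h' := h a X default
  rw [Subsingleton.elim (default : Fin 0 → PowersetQuotient 𝓘) Fin.elim0] at h'
  rw [Fin.append_elim0] at h'
  rw [hψ]
  have hv : (fun j => (Sum.elim s BoolTerm.var j : BoolTerm Φ m k).realize a X) =
      Sum.elim (fun φ => supp φ a) X := by
    funext j
    rcases j with φ | j
    · exact hs φ a X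
    · rfl
  rw [hv] at h'
  refine Iff.trans (iff_of_eq ?_) h'.symm
  exact congrArg (BoundedFormula.Realize ψ _) (Subsingleton.elim _ _)

end FefermanVaught

end FV

theorem theorem2p21 {L : FirstOrder.Language.{u, v}} {I : Type w} (𝓘 : Order.Ideal (Set I))
    [𝓘.IsProper] (M : I → Type x) [∀ i, L.Structure (M i)] [∀ i, Nonempty (M i)]
    -- a fundamental set of `h`-formulas
    (Φ : ∀ n, Set (L.Formula (Fin n)))
    (hΦ : ∀ n, ∀ φ ∈ Φ n, FV.IsHFormula φ)
    (hfund : FV.IsFundamental 𝓘 M Φ)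
    -- the formulas of `Φ`, or else the relation symbols, are satisfiable in the reduced product
    (hsat : (∀ n, ∀ φ ∈ Φ n, ∃ a : Fin n → FV.ReducedProduct 𝓘 M, φ.Realize a) ∨
      (∀ n, ∀ R : L.Relations n, ∃ a : Fin n → FV.ReducedProduct 𝓘 M,
        FirstOrder.Language.Structure.RelMap R a))
    -- an interpretation of `P(I)/𝓘` and of the relative support function
    (A : Set (FV.ReducedProduct 𝓘 M)) (c : FV.Coding 𝓘 M) (hc : c.IsInterpretation L A)
    (hsupp : c.InterpretsFunction L A (p := 2) fun a => FV.suppEq (a 0) (a 1)) :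
    (∀ (n : ℕ) (φ : L.Formula (Fin n)), c.InterpretsFunction L A (FV.supp φ)) ∧
      FV.EliminatesQuantifiersRelative Φ 𝓘 M := by
  refine ⟨fun n φ => ?_, FV.eliminatesQuantifiersRelative_of_isFundamental hfund⟩
  rcases hsat with hsat | hrel
  -- Formulas equivalent in almost all `M i` have equal supports, so `φ` may be replaced by a
  -- Boolean combination of satisfiable `h`-formulas.
  · obtain ⟨β, hβ, hφβ⟩ := hfund n φ
    rw [FV.supp_eq_of_equivModulo hφβ]
    exact FV.Coding.interprets_supp_of_isBooleanCombination hc (fun n ψ hψ =>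
      FV.Coding.interprets_supp_of_isHFormula hc hsupp (hΦ n ψ hψ) (hsat n ψ hψ)) hβ
  · exact FV.Coding.interprets_supp_of_relations hc hsupp hrel φ
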